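/- **Setting.** Let $\Sigma$ be a finite alphabet with two distinct letters $0,1\in\Sigma$, let $\mathbb W=\Sigma^*$, let $\mathbb V$ be a set of variables and $\mathbb O$ a set of operators; each $op\in\mathbb O$ has an arity $k=ar(op)$ and a total function $[\![op]\!]:\mathbb W^{k}\to\mathbb W$. Expressions, statements and programs are $$e ::= x \mid op(e_1,\dots,e_{ar(op)}) \mid \mathrm{declass}(e,e),$$ $$s ::= \mathrm{skip} \mid x:=e \mid s;s \mid \mathrm{if}(e)\{s\}\,\mathrm{else}\,\{s\} \mid \mathrm{while}(e)\{s\} \mid \mathrm{break}(e),\qquad P ::= \mathrm{prog}(x_1,\dots,x_n)\{s\ \mathrm{return}\ y\}.$$ **Semantics.** A store $\mu$ is a total map $\mathbb V\to\mathbb W$; expressions evaluate in the standard way, and $\mathrm{declass}(e_1,e_2)$ evaluates to $1^{\min(|w_1|,|w_2|)}$ when $e_1,e_2$ evaluate to $w_1,w_2$. The word $1$ is true and every other word is false. Statements have a standard big-step semantics $(\mu,s)\to(\square,\mu')$ with a flag $\square\in\{\top,\bot\}$: $\mathrm{break}(e)$ returns $\bot$ if $e$ is true and $\top$ otherwise;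 $\bot$ skips the rest of a sequence; $\mathrm{while}(e)\{s\}$ returns $\top$ with the same store if $e$ is false, and otherwise evaluates $s;\mathrm{while}(e)\{s\}$ and returns $\top$ with the resulting store. The evaluation tree of $(\mu,s)$ is the possibly infinite tree of configurations obtained with these rules. The program $P$ computes the partial function $[\![P]\!]:\mathbb W^n\to\mathbb W$ with $[\![P]\!](\bar w)=v$ iff $(\mu_\emptyset[\bar x\leftarrow\bar w],s)\to(\top,\mu')$ for some $\mu'$ with $\mu'(y)=v$, where $\mu_\emptyset$ maps every variable to the empty word. **Operators.** An operator $op$ of arity $k$ is *neutral* if $[\![op]\!]$ takes only the values $0,1$ or if there is $i\le k$ such that $[\![op]\!](\bar w)$ is a (contiguous) subword of $w_i$ for all $\bar w$; *positive* if there is $c\in\mathbb N$ with $|[\![op]\!](\bar w)|\le\max_i|w_i|+c$ for all $\bar w$; *polynomial* if there is $p\in\mathbb N[X]$ with $|[\![op]\!](\bar w)|\le p(\max_i|w_i|)$ for all $\bar w$ (an empty maximum is $0$). **Types.** Levels are natural numbers. A variable typing environment $\Gamma$ is a partial map $\mathbb V\to\mathbb N$. An operator typing environment $\Delta$ assigns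 to each $op$ in its domain and each $(i,o)\in\mathbb N^2$ a set $\Delta(op)(i,o)$ of functional levels $\tau_1\to\dots\to\tau_{k}\to\tau'$. It is *safe* if every $op$ in its domain is neutral, positive or polynomial, $[\![op]\!]$ is polynomial-time computable, and for each such functional level in $\Delta(op)(i,o)$: if $op$ is neutral, then $\tau'\le\tau_j$ for all $j$; if $op$ is positive and not neutral, then $\tau'\le\tau_j$ for all $j$, and $\tau'<i$ or $\tau'=0$; if $op$ is polynomial and not positive, then $o=0$. The judgments $\vdash^i_o$ (innermost level $i$, outermost level $o$), relative to $\Gamma,\Delta$, are generated by the rules: * $\vdash^i_o x:\Gamma(x)$; * $\vdash^i_o op(e_1,\dots,e_k):\tau'$ if $(\tau_1\to\dots\to\tau_k\to\tau')\in\Delta(op)(i,o)$ and $\vdash^i_o e_j:\tau_j$ for all $j$; * $\vdash^i_o\mathrm{declass}(e_1,e_2):\tau$ if $\vdash^i_o e_1:\tau_1$, $\vdash^i_o e_2:o$ and $\tau_1\le\tau\le o$; * $\vdash^i_o s:\tau_2$ if $\vdash^i_o s:\tau_1$ and $\tau_1\le\tau_2$ (statements only); * $\vdash^i_o\mathrm{skip}:0$;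 * $\vdash^i_o x:=e:\Gamma(x)$ if $\vdash^i_o e:\tau_2$, and $o=0$ or $\Gamma(x)\le\tau_2$; * $\vdash^i_o s_1;s_2:\tau$ if $\vdash^i_o s_1:\tau$ and $\vdash^i_o s_2:\tau$; * $\vdash^i_o\mathrm{if}(e)\{s_1\}\,\mathrm{else}\,\{s_0\}:\tau$ if $\vdash^i_o e:\tau$, $\vdash^i_o s_1:\tau$ and $\vdash^i_o s_0:\tau$; * $\vdash^i_o\mathrm{while}(e)\{s\}:\tau$ if $\vdash^\tau_o e:\tau$, $\vdash^\tau_o s:\tau$ and $1\le\tau\le o$; * $\vdash^0_0\mathrm{while}(e)\{s\}:\tau$ if $\vdash^\tau_\tau e:\tau$, $\vdash^\tau_\tau s:\tau$ and $1\le\tau$; * $\vdash^i_o\mathrm{break}(e):i$ if $\vdash^i_o e:\tau$ and $i\le\tau$. A program with body $s$ is *safe* if there are a safe $\Delta$, a $\Gamma$ and a level $\tau$ with $\vdash^0_0 s:\tau$. **Aperiodicity.** The undeclassified variables of an expression are $U(x)=\{x\}$, $U(op(\bar e))=\bigcup_j U(e_j)$, $U(\mathrm{declass}(e_1,e_2))=U(e_2)$.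 A program with body $s$ is *aperiodic* if for no store $\mu$ the evaluation tree of $(\mu,s)$ contains a node $(\mu',\mathrm{while}(e)\{s''\})$ with a proper descendant $(\mu'',\mathrm{while}(e)\{s''\})$ such that $\mu'(x)=\mu''(x)$ for all $x\in U(e)$. **Theorem (Soundness).** Let $P$ be a safe and aperiodic program of arity $n$ in which no break takes effect outside of all loops, i.e. on no input $\bar w\in\mathbb W^n$ does the evaluation of the body of $P$ end with the flag $\bot$. Then $[\![P]\!]$ is a total function $\mathbb W^n\to\mathbb W$ and it belongs to $\mathtt{FP}$, the class of functions computable in polynomial time by a Turing machine. -/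

import Mathlib

universe u v

namespace Declass

/-! ### Words, operators, polynomial-time functions -/

/-- An alphabet with two distinguished distinct letters `0` and `1`. -/
class BitAlphabet (A : Type) where
  zero : A
  one : A
  zero_ne_one : zero ≠ one

/-- Words over the alphabet `A`; they are the values of the language. -/
abbrev Word (A : Type) : Type := List A

/-- The one-letter word `0`. -/
def wordZero {A : Type} [BitAlphabet A] : Word A := [BitAlphabet.zero]

/-- The one-letter word `1`, the truth value "true"; any other word counts as false. -/
def wordOne {A : Type} [BitAlphabet A] : Word A := [BitAlphabet.one]

/-- The unary number `1^n`. -/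
def unary {A : Type} [BitAlphabet A] (n : ℕ) : Word A := List.replicate n BitAlphabet.one

/-- A tuple of words as a single word over `A` with one additional letter `none`, which is written
at the end of every component. -/
def encodeTuple {A : Type} {n : ℕ} (w : Fin n → Word A) : List (Option A) :=
  (List.ofFn w).flatMap fun u => u.map some ++ [none]

/-- `f` is computable in polynomial time by a (multi-stack) Turing machine. -/
def InFP {A : Type} {n : ℕ} (f : (Fin n → Word A) → Word A) : Prop :=
  Nonempty (Turing.TM2ComputableInPolyTime (αΓ := Option A) (βΓ := A) encodeTuple (fun v => v) f)

/-- A set of operators, each with an arity and a total function on words. -/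
structure Operators (A : Type) where
  Op : Type u
  ar : Op → ℕ
  sem : (o : Op) → (Fin (ar o) → Word A) → Word A

/-- The maximal length of a component of a tuple (`0` for the empty tuple). -/
def maxLength {A : Type} {n : ℕ} (w : Fin n → Word A) : ℕ :=
  Finset.univ.sup fun i => (w i).length

/-- A neutral function: a predicate, or a function whose value is always a subword
(contiguous factor) of one fixed argument. -/
def IsNeutral {A : Type} [BitAlphabet A] {n : ℕ} (f : (Fin n → Word A) → Word A) : Prop :=
  (∀ w, f w = wordZero ∨ f w = wordOne) ∨ ∃ i : Fin n, ∀ w, f w <:+: w i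

/-- A function increasing the maximal length by at most a constant. -/
def IsPositive {A : Type} {n : ℕ} (f : (Fin n → Word A) → Word A) : Prop :=
  ∃ c : ℕ, ∀ w, (f w).length ≤ maxLength w + c

/-- A function increasing the maximal length at most polynomially. -/
def IsPolynomial {A : Type} {n : ℕ} (f : (Fin n → Word A) → Word A) : Prop :=
  ∃ p : Polynomial ℕ, ∀ w, (f w).length ≤ p.eval (maxLength w)

/-! ### The language -/

/-- Expressions over the operators `S` and the variables `V`. -/
inductive Expr {A : Type} (S : Operators.{u} A) (V : Type v) : Type (max u v)
  | var (x : V) : Expr S V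
  | op (o : S.Op) (args : Fin (S.ar o) → Expr S V) : Expr S V
  | declass (e₁ e₂ : Expr S V) : Expr S V

/-- Statements. -/
inductive Stmt {A : Type} (S : Operators.{u} A) (V : Type v) : Type (max u v)
  | skip : Stmt S V
  | assign (x : V) (e : Expr S V) : Stmt S V
  | seq (s₁ s₂ : Stmt S V) : Stmt S V
  | ite (e : Expr S V) (s₁ s₀ : Stmt S V) : Stmt S V
  | loop (e : Expr S V) (s : Stmt S V) : Stmt S V
  | brk (e : Expr S V) : Stmt S V

/-- A program `prog(params) { body return result }`. -/
structure Program {A : Type} (S : Operators.{u} A) (V : Type v) where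
  arity : ℕ
  params : Fin arity → V
  body : Stmt S V
  result : V

/-- Memory stores: total maps from variables to words. -/
abbrev Store (A : Type) (V : Type v) : Type v := V → Word A

section Semantics

variable {A : Type} [BitAlphabet A] {S : Operators.{u} A} {V : Type v}

/-- The value of an expression in a store. -/
def Expr.eval (μ : Store A V) : Expr S V → Word A
  | .var x => μ x
  | .op o args => S.sem o fun i => (args i).eval μ
  | .declass e₁ e₂ => unary (min (e₁.eval μ).length (e₂.eval μ).length)

/-- The flag returned by a statement: `cont` if the flow goes on, `broken` if it is being broken. -/
inductive Flag
  | cont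
  | broken

variable [DecidableEq V]

/-- Big-step semantics: `Eval μ s b μ'` means that `s`, started in the store `μ`, terminates with
the flag `b` in the store `μ'`. -/
inductive Eval : Store A V → Stmt S V → Flag → Store A V → Prop
  | skip (μ) : Eval μ .skip .cont μ
  | assign (μ x) (e : Expr S V) :
      Eval μ (.assign x e) .cont (Function.update μ x (e.eval μ))
  | seq {μ μ' μ'' : Store A V} {s₁ s₂ : Stmt S V} {b : Flag} :
      Eval μ s₁ .cont μ' → Eval μ' s₂ b μ'' → Eval μ (.seq s₁ s₂) b μ''
  | seq_broken {μ μ' : Store A V} {s₁ s₂ : Stmt S V} :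
      Eval μ s₁ .broken μ' → Eval μ (.seq s₁ s₂) .broken μ'
  | ite_true {μ μ' : Store A V} {e : Expr S V} {s₁ s₀ : Stmt S V} {b : Flag} :
      e.eval μ = wordOne → Eval μ s₁ b μ' → Eval μ (.ite e s₁ s₀) b μ'
  | ite_false {μ μ' : Store A V} {e : Expr S V} {s₁ s₀ : Stmt S V} {b : Flag} :
      e.eval μ ≠ wordOne → Eval μ s₀ b μ' → Eval μ (.ite e s₁ s₀) b μ'
  | loop_false {μ : Store A V} {e : Expr S V} {s : Stmt S V} :
      e.eval μ ≠ wordOne → Eval μ (.loop e s) .cont μ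
  | loop_true {μ μ' : Store A V} {e : Expr S V} {s : Stmt S V} {b : Flag} :
      e.eval μ = wordOne → Eval μ (.seq s (.loop e s)) b μ' → Eval μ (.loop e s) .cont μ'
  | brk_false {μ : Store A V} {e : Expr S V} :
      e.eval μ ≠ wordOne → Eval μ (.brk e) .cont μ
  | brk_true {μ : Store A V} {e : Expr S V} :
      e.eval μ = wordOne → Eval μ (.brk e) .broken μ

/-- `Child c c'`: in the (possibly infinite) evaluation tree, a node labelled by the configuration
`c` has a child labelled by `c'`. Only statement configurations are recorded, as expression
configurations have no statement below them. -/
inductive Child : Store A V × Stmt S V → Store A V × Stmt S V → Prop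
  | seq_left (μ : Store A V) (s₁ s₂ : Stmt S V) : Child (μ, .seq s₁ s₂) (μ, s₁)
  | seq_right {μ μ' : Store A V} {s₁ : Stmt S V} (s₂ : Stmt S V) :
      Eval μ s₁ .cont μ' → Child (μ, .seq s₁ s₂) (μ', s₂)
  | ite_true {μ : Store A V} {e : Expr S V} (s₁ s₀ : Stmt S V) :
      e.eval μ = wordOne → Child (μ, .ite e s₁ s₀) (μ, s₁)
  | ite_false {μ : Store A V} {e : Expr S V} (s₁ s₀ : Stmt S V) :
      e.eval μ ≠ wordOne → Child (μ, .ite e s₁ s₀) (μ, s₀)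
  | loop {μ : Store A V} {e : Expr S V} (s : Stmt S V) :
      e.eval μ = wordOne → Child (μ, .loop e s) (μ, .seq s (.loop e s))

/-- The input store: every variable holds the empty word, except that the parameters hold the
input words (assigned from left to right). -/
def Program.inputStore (P : Program S V) (w : Fin P.arity → Word A) : Store A V :=
  (List.finRange P.arity).foldl (fun μ i => Function.update μ (P.params i) (w i)) fun _ => []

/-- The (graph of the) partial function computed by a program. -/
def Program.Computes (P : Program S V) (w : Fin P.arity → Word A) (r : Word A) : Prop :=
  ∃ μ', Eval (P.inputStore w) P.body .cont μ' ∧ μ' P.result = r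

/-- No `break` takes effect outside of all loops: on no input does the body end with the flag
`broken`. -/
def Program.NoEscapingBreak (P : Program S V) : Prop :=
  ∀ (w : Fin P.arity → Word A) (μ' : Store A V), ¬ Eval (P.inputStore w) P.body .broken μ'

/-- Undeclassified variables of an expression. -/
def Expr.undeclassified : Expr S V → Set V
  | .var x => {x}
  | .op _ args => ⋃ i, (args i).undeclassified
  | .declass _ e₂ => e₂.undeclassified

/-- Stores that agree on the undeclassified variables of `e`. -/
def StoreEquiv (e : Expr S V) (μ μ' : Store A V) : Prop :=
  ∀ x ∈ e.undeclassified, μ x = μ' x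

/-- Aperiodicity: no evaluation tree of the body contains a loop node with a proper descendant that
is a node of the same loop with an equivalent store. -/
def Program.Aperiodic (P : Program S V) : Prop :=
  ∀ μ : Store A V, ¬ ∃ (μ' μ'' : Store A V) (e : Expr S V) (s : Stmt S V),
    Relation.ReflTransGen Child (μ, P.body) (μ', .loop e s) ∧
    Relation.ReflTransGen Child (μ, P.body) (μ'', .loop e s) ∧
    Relation.TransGen Child (μ', .loop e s) (μ'', .loop e s) ∧
    StoreEquiv e μ' μ''

end Semantics

/-! ### The type system -/

section Typing

variable {A : Type} [BitAlphabet A] {S : Operators.{u} A} {V : Type v}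

/-- Variable typing environments: partial maps from variables to levels. (Finiteness of the domain
is immaterial, as only finitely many variables occur in a program.) -/
abbrev VarEnv (V : Type v) : Type v := V → Option ℕ

/-- Operator typing environments. For `o ∈ dom`, innermost level `i` and outermost level `j`, the
set `types o i j` contains the admissible functional levels `τ 0 → ⋯ → τ (k-1) → τ'` of `o`, as
pairs `(τ, τ')`. -/
structure OpEnv {A : Type} (S : Operators.{u} A) where
  dom : Set S.Op
  types : (o : S.Op) → ℕ → ℕ → Set ((Fin (S.ar o) → ℕ) × ℕ)

/-- Safe operator typing environments. -/
def OpEnv.Safe (Δ : OpEnv S) : Prop :=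
  ∀ o ∈ Δ.dom,
    (IsNeutral (S.sem o) ∨ IsPositive (S.sem o) ∨ IsPolynomial (S.sem o)) ∧
    InFP (S.sem o) ∧
    ∀ (lin lout : ℕ) (τ : Fin (S.ar o) → ℕ) (τ' : ℕ), (τ, τ') ∈ Δ.types o lin lout →
      (IsNeutral (S.sem o) → ∀ i, τ' ≤ τ i) ∧
      (IsPositive (S.sem o) ∧ ¬ IsNeutral (S.sem o) →
        (∀ i, τ' ≤ τ i) ∧ (τ' < lin ∨ τ' = 0)) ∧
      (IsPolynomial (S.sem o) ∧ ¬ IsNeutral (S.sem o) ∧ ¬ IsPositive (S.sem o) → lout = 0)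

/-- Typing of expressions, with innermost level `lin` and outermost level `lout`. -/
inductive ExprTyped (Γ : VarEnv V) (Δ : OpEnv S) : (lin lout : ℕ) → Expr S V → ℕ → Prop
  | var {lin lout : ℕ} {x : V} {τ : ℕ} : Γ x = some τ → ExprTyped Γ Δ lin lout (.var x) τ
  | op {lin lout : ℕ} {o : S.Op} {args : Fin (S.ar o) → Expr S V}
      {τ : Fin (S.ar o) → ℕ} {τ' : ℕ} :
      o ∈ Δ.dom → (τ, τ') ∈ Δ.types o lin lout →
      (∀ i, ExprTyped Γ Δ lin lout (args i) (τ i)) →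
      ExprTyped Γ Δ lin lout (.op o args) τ'
  | declass {lin lout : ℕ} {e₁ e₂ : Expr S V} {τ₁ τ : ℕ} :
      ExprTyped Γ Δ lin lout e₁ τ₁ → ExprTyped Γ Δ lin lout e₂ lout →
      τ₁ ≤ τ → τ ≤ lout →
      ExprTyped Γ Δ lin lout (.declass e₁ e₂) τ

/-- Typing of statements, with innermost level `lin` and outermost level `lout`. -/
inductive StmtTyped (Γ : VarEnv V) (Δ : OpEnv S) : (lin lout : ℕ) → Stmt S V → ℕ → Prop
  | sub {lin lout : ℕ} {s : Stmt S V} {τ₁ τ₂ : ℕ} :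
      StmtTyped Γ Δ lin lout s τ₁ → τ₁ ≤ τ₂ → StmtTyped Γ Δ lin lout s τ₂
  | skip {lin lout : ℕ} : StmtTyped Γ Δ lin lout .skip 0
  | assign {lin lout : ℕ} {x : V} {e : Expr S V} {τ₁ τ₂ : ℕ} :
      Γ x = some τ₁ → ExprTyped Γ Δ lin lout e τ₂ → (lout = 0 ∨ τ₁ ≤ τ₂) →
      StmtTyped Γ Δ lin lout (.assign x e) τ₁
  | seq {lin lout : ℕ} {s₁ s₂ : Stmt S V} {τ : ℕ} :
      StmtTyped Γ Δ lin lout s₁ τ → StmtTyped Γ Δ lin lout s₂ τ →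
      StmtTyped Γ Δ lin lout (.seq s₁ s₂) τ
  | ite {lin lout : ℕ} {e : Expr S V} {s₁ s₀ : Stmt S V} {τ : ℕ} :
      ExprTyped Γ Δ lin lout e τ →
      StmtTyped Γ Δ lin lout s₁ τ → StmtTyped Γ Δ lin lout s₀ τ →
      StmtTyped Γ Δ lin lout (.ite e s₁ s₀) τ
  /-- A loop nested in another one. -/
  | loop_inner {lin lout : ℕ} {e : Expr S V} {s : Stmt S V} {τ : ℕ} :
      ExprTyped Γ Δ τ lout e τ → StmtTyped Γ Δ τ lout s τ →
      1 ≤ τ → τ ≤ lout →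
      StmtTyped Γ Δ lin lout (.loop e s) τ
  /-- An outermost loop. -/
  | loop_outer {e : Expr S V} {s : Stmt S V} {τ : ℕ} :
      ExprTyped Γ Δ τ τ e τ → StmtTyped Γ Δ τ τ s τ →
      1 ≤ τ →
      StmtTyped Γ Δ 0 0 (.loop e s) τ
  | brk {lin lout : ℕ} {e : Expr S V} {τ : ℕ} :
      ExprTyped Γ Δ lin lout e τ → lin ≤ τ →
      StmtTyped Γ Δ lin lout (.brk e) lin

/-- Safe programs. -/
def Program.Safe (P : Program S V) : Prop :=
  ∃ Δ : OpEnv S, Δ.Safe ∧ ∃ (Γ : VarEnv V) (τ : ℕ), StmtTyped Γ Δ 0 0 P.body τ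

end Typing

end Declass

/-!
The proof has two parts: a safe and aperiodic program makes polynomially many steps through stores
of polynomial size, and such computations are carried out by a Turing machine.

**Polynomially many steps.** Consider a loop at top level; its level `o` is the outermost level
inside it. Inside a loop of level `j`, a positive operator has a result of level below `j` (or of
level `0`), and operators that are neither neutral nor positive do not occur. Hence expressions of
level at least `j` are built by neutral operators and declassification only. In particular the
variables of level `o` never get longer than some `M`, which also bounds all declassified values
(`ExprTyped.length_le_of_outermost`), and during a loop of level `j` the variables of level at least
`j` hold subwords of their values on entry, truth values, and unary numbers up to `M`
(`ExprTyped.eval_mem`, `Trace.valuesIn`). The undeclassified variables of the guard have level at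
least `j` (`ExprTyped.level_of_undeclassified`), and by aperiodicity no two iterations start with
the same values of these variables; so the number of iterations is polynomial in the lengths of the
variables of level at least `j` (`History.length_le`). This also shows termination
(`Leveled.exists_trace`). Conversely, the variables of level `j` grow, by a constant at a time, only
in steps inside loops of level greater than `j` (`Trace.length_le`). Descending induction on the
level bounds the number of steps and the lengths of all variables (`Leveled.exists_polynomial`).
Outside of loops polynomial operators may occur, but each statement is executed at most once
(`StmtTyped.exists_trace`).

The argument is about executions of statements whose loops carry their levels (`LStmt`, `Leveled`),
recorded as lists of steps (`Trace`), each one with its store and the level of the loop around it.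

**Simulation.** A typing derivation involves only finitely many variables and operators
(`StmtTyped.exists_finite`), so a machine can have one stack for each variable, a work stack for
evaluating expressions, some auxiliary stacks, and the stacks of the machines of the operators,
which it runs as subroutines (`exec_runOp`). Machine programs are put together from fragments
(`Frag`) by sequential composition, branching and iteration. Expressions push their values on the
work stack (`ExprTyped.exists_pushes`), each step of a trace takes time polynomial in the size of
its store (`LStmt.Supported.exists_simulates`), and with the transfer of the input and of the result
this gives a polynomial-time machine (`Program.inFP_of_simulates`).
-/

namespace Declass

/-! ### Expressions inside loops -/

section Expressions

variable {A : Type} [BitAlphabet A] {S : Operators.{u} A} {V : Type v}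

theorem polynomial_eval_mono (p : Polynomial ℕ) {m n : ℕ} (h : m ≤ n) : p.eval m ≤ p.eval n := by
  rw [Polynomial.eval_eq_sum_range, Polynomial.eval_eq_sum_range]
  gcongr

/-- The variable typing environment with domain `X` that agrees with `Γ` where `Γ` is defined; the
other variables in `X` get level `0`. -/
noncomputable def VarEnv.restrict (Γ : VarEnv V) (X : Set V) : VarEnv V :=
  open Classical in fun x => if x ∈ X then some ((Γ x).getD 0) else none

/-- The restriction of an operator typing environment to a set of operators. -/
def OpEnv.restrict (Δ : OpEnv S) (O : Set S.Op) : OpEnv S := ⟨Δ.dom ∩ O, Δ.types⟩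

theorem VarEnv.restrict_of_mem {Γ : VarEnv V} {X : Set V} {x : V} (hx : x ∈ X) {τ : ℕ}
    (hτ : Γ x = some τ) : Γ.restrict X x = some τ := by
  simp [VarEnv.restrict, hx, hτ]

theorem VarEnv.mem_of_restrict {Γ : VarEnv V} {X : Set V} {x : V} {τ : ℕ}
    (hx : Γ.restrict X x = some τ) : x ∈ X := by
  by_contra h
  simp [VarEnv.restrict, h] at hx

theorem OpEnv.Safe.restrict {Δ : OpEnv S} (h : Δ.Safe) (O : Set S.Op) : (Δ.restrict O).Safe :=
  fun o ho => h o ho.1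

omit [BitAlphabet A] in
/-- A typing derivation of an expression involves only finitely many variables and operators. -/
theorem ExprTyped.exists_finite {Γ : VarEnv V} {Δ : OpEnv S} {i o τ : ℕ} {e : Expr S V}
    (h : ExprTyped Γ Δ i o e τ) :
    ∃ (X : Set V) (O : Set S.Op), X.Finite ∧ O.Finite ∧ ∀ X' O', X ⊆ X' → O ⊆ O' →
      ExprTyped (Γ.restrict X') (Δ.restrict O') i o e τ := by
  induction h with
  | @var x τ hx =>
    refine ⟨{x}, ∅, Set.finite_singleton _, Set.finite_empty, fun X' O' hX _ => .var ?_⟩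
    exact VarEnv.restrict_of_mem (hX rfl) hx
  | @op f args τ τ' hf ht _ ih =>
    choose X O hX hO h using ih
    refine ⟨⋃ k, X k, insert f (⋃ k, O k), Set.finite_iUnion hX, (Set.finite_iUnion hO).insert _,
      fun X' O' hX' hO' => ?_⟩
    rw [Set.insert_subset_iff] at hO'
    exact .op ⟨hf, hO'.1⟩ ht fun k => h k _ _ ((Set.subset_iUnion X k).trans hX')
      ((Set.subset_iUnion O k).trans hO'.2)
  | declass _ _ h₁ h₂ ih₁ ih₂ =>
    obtain ⟨X₁, O₁, hX₁, hO₁, ih₁⟩ := ih₁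
    obtain ⟨X₂, O₂, hX₂, hO₂, ih₂⟩ := ih₂
    refine ⟨X₁ ∪ X₂, O₁ ∪ O₂, hX₁.union hX₂, hO₁.union hO₂, fun X' O' hX hO => ?_⟩
    rw [Set.union_subset_iff] at hX hO
    exact .declass (ih₁ _ _ hX.1 hO.1) (ih₂ _ _ hX.2 hO.2) h₁ h₂

omit [BitAlphabet A] in
/-- A typing derivation of a statement involves only finitely many variables and operators. -/
theorem StmtTyped.exists_finite {Γ : VarEnv V} {Δ : OpEnv S} {i o τ : ℕ} {s : Stmt S V}
    (h : StmtTyped Γ Δ i o s τ) :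
    ∃ (X : Set V) (O : Set S.Op), X.Finite ∧ O.Finite ∧ ∀ X' O', X ⊆ X' → O ⊆ O' →
      StmtTyped (Γ.restrict X') (Δ.restrict O') i o s τ := by
  induction h with
  | sub _ hτ ih =>
    obtain ⟨X, O, hX, hO, ih⟩ := ih
    exact ⟨X, O, hX, hO, fun X' O' h₁ h₂ => .sub (ih X' O' h₁ h₂) hτ⟩
  | skip => exact ⟨∅, ∅, Set.finite_empty, Set.finite_empty, fun _ _ _ _ => .skip⟩
  | @assign i o x e τ₁ τ₂ hx he hτ =>
    obtain ⟨X, O, hX, hO, ih⟩ := he.exists_finite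
    refine ⟨insert x X, O, hX.insert x, hO, fun X' O' h₁ h₂ => ?_⟩
    rw [Set.insert_subset_iff] at h₁
    exact .assign (VarEnv.restrict_of_mem h₁.1 hx) (ih _ _ h₁.2 h₂) hτ
  | seq _ _ ih₁ ih₂ =>
    obtain ⟨X₁, O₁, hX₁, hO₁, ih₁⟩ := ih₁
    obtain ⟨X₂, O₂, hX₂, hO₂, ih₂⟩ := ih₂
    refine ⟨X₁ ∪ X₂, O₁ ∪ O₂, hX₁.union hX₂, hO₁.union hO₂, fun X' O' hX hO => ?_⟩
    rw [Set.union_subset_iff] at hX hO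
    exact .seq (ih₁ _ _ hX.1 hO.1) (ih₂ _ _ hX.2 hO.2)
  | ite he _ _ ih₁ ih₂ =>
    obtain ⟨X₀, O₀, hX₀, hO₀, ih₀⟩ := he.exists_finite
    obtain ⟨X₁, O₁, hX₁, hO₁, ih₁⟩ := ih₁
    obtain ⟨X₂, O₂, hX₂, hO₂, ih₂⟩ := ih₂
    refine ⟨X₀ ∪ (X₁ ∪ X₂), O₀ ∪ (O₁ ∪ O₂), hX₀.union (hX₁.union hX₂),
      hO₀.union (hO₁.union hO₂), fun X' O' hX hO => ?_⟩
    rw [Set.union_subset_iff, Set.union_subset_iff] at hX hO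
    exact .ite (ih₀ _ _ hX.1 hO.1) (ih₁ _ _ hX.2.1 hO.2.1) (ih₂ _ _ hX.2.2 hO.2.2)
  | loop_inner he _ h₁ h₂ ih =>
    obtain ⟨X₀, O₀, hX₀, hO₀, ih₀⟩ := he.exists_finite
    obtain ⟨X₁, O₁, hX₁, hO₁, ih₁⟩ := ih
    refine ⟨X₀ ∪ X₁, O₀ ∪ O₁, hX₀.union hX₁, hO₀.union hO₁, fun X' O' hX hO => ?_⟩
    rw [Set.union_subset_iff] at hX hO
    exact .loop_inner (ih₀ _ _ hX.1 hO.1) (ih₁ _ _ hX.2 hO.2) h₁ h₂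
  | loop_outer he _ h₁ ih =>
    obtain ⟨X₀, O₀, hX₀, hO₀, ih₀⟩ := he.exists_finite
    obtain ⟨X₁, O₁, hX₁, hO₁, ih₁⟩ := ih
    refine ⟨X₀ ∪ X₁, O₀ ∪ O₁, hX₀.union hX₁, hO₀.union hO₁, fun X' O' hX hO => ?_⟩
    rw [Set.union_subset_iff] at hX hO
    exact .loop_outer (ih₀ _ _ hX.1 hO.1) (ih₁ _ _ hX.2 hO.2) h₁
  | brk he h₁ =>
    obtain ⟨X, O, hX, hO, ih⟩ := he.exists_finite
    exact ⟨X, O, hX, hO, fun X' O' hX hO => .brk (ih _ _ hX hO) h₁⟩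

/-- All variables of level at least `j` hold words of length at most `B`. -/
def BoundedFrom (Γ : VarEnv V) (j B : ℕ) (μ : Store A V) : Prop :=
  ∀ x l, Γ x = some l → j ≤ l → (μ x).length ≤ B

omit [BitAlphabet A] in
theorem BoundedFrom.mono {Γ : VarEnv V} {j j' B B' : ℕ} {μ : Store A V}
    (h : BoundedFrom Γ j B μ) (hj : j ≤ j') (hB : B ≤ B') : BoundedFrom Γ j' B' μ :=
  fun x l hx hl => (h x l hx (hj.trans hl)).trans hB

/-- Inside loops, that is, at a nonzero outermost level, only neutral and positive operators are
typable. -/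
theorem OpEnv.Safe.neutral_or_positive {Δ : OpEnv S} (hΔ : Δ.Safe) {f : S.Op} (hf : f ∈ Δ.dom)
    {i o τ' : ℕ} {τ : Fin (S.ar f) → ℕ} (ht : (τ, τ') ∈ Δ.types f i o) (ho : 1 ≤ o) :
    (∀ k, τ' ≤ τ k) ∧ (IsNeutral (S.sem f) ∨ IsPositive (S.sem f) ∧ (τ' < i ∨ τ' = 0)) := by
  obtain ⟨hor, -, h⟩ := hΔ f hf
  obtain ⟨h₁, h₂, h₃⟩ := h i o τ τ' ht
  by_cases hn : IsNeutral (S.sem f)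
  · exact ⟨h₁ hn, .inl hn⟩
  by_cases hp : IsPositive (S.sem f)
  · exact ⟨(h₂ ⟨hp, hn⟩).1, .inr ⟨hp, (h₂ ⟨hp, hn⟩).2⟩⟩
  have := h₃ ⟨by tauto, hn, hp⟩
  omega

/-- Expressions of at least the outermost level are not longer than the variables of that level: no
positive operator occurs in them, as its result would have a level below the innermost one. The
second argument of a declassification has the outermost level, so this bounds all declassified
values. -/
theorem ExprTyped.length_le_of_outermost {Γ : VarEnv V} {Δ : OpEnv S} (hΔ : Δ.Safe)
    {i o τ M : ℕ} {e : Expr S V} {μ : Store A V} (h : ExprTyped Γ Δ i o e τ)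
    (ho : 1 ≤ o) (hio : i ≤ o) (hM : 1 ≤ M) (hμ : BoundedFrom Γ o M μ) (hτ : o ≤ τ) :
    (e.eval μ).length ≤ M := by
  induction h with
  | var hx => exact hμ _ _ hx hτ
  | @op f args τ τ' hf ht _ ih =>
    obtain ⟨hle, hn | hp⟩ := hΔ.neutral_or_positive hf ht ho
    · rcases hn with hn | ⟨k, hn⟩
      · rcases hn fun k => (args k).eval μ with h | h <;> simp [Expr.eval, h, wordZero, wordOne, hM]
      · exact (hn _).length_le.trans (ih k (hτ.trans (hle k)))
    · omega
  | @declass e₁ e₂ τ₁ τ _ _ _ _ _ ih₂ =>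
    have := ih₂ le_rfl
    simp only [Expr.eval, unary, List.length_replicate]
    omega

/-- A set `C` of words closed under subwords contains the values of the expressions of level at
least `j ≥ i`, provided that it contains the truth values, the unary numbers that declassification
may produce, and the values of the variables of level at least `j`. Again no positive operator can
occur in such expressions. -/
theorem ExprTyped.eval_mem {Γ : VarEnv V} {Δ : OpEnv S} (hΔ : Δ.Safe) {i o j τ M : ℕ}
    {e : Expr S V} {μ : Store A V} (h : ExprTyped Γ Δ i o e τ) (hi : i ≤ j) (hj : 1 ≤ j)
    (hjo : j ≤ o) (hM : 1 ≤ M) (hμ : BoundedFrom Γ o M μ)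
    {C : Set (Word A)} (hC : ∀ u ∈ C, ∀ v, v <:+: u → v ∈ C) (h0 : wordZero ∈ C)
    (hu : ∀ k ≤ M, unary k ∈ C) (hμC : ∀ x l, Γ x = some l → j ≤ l → μ x ∈ C) (hτ : j ≤ τ) :
    e.eval μ ∈ C := by
  induction h with
  | var hx => exact hμC _ _ hx hτ
  | @op f args τ τ' hf ht _ ih =>
    obtain ⟨hle, hn | hp⟩ := hΔ.neutral_or_positive hf ht (hj.trans hjo)
    · rcases hn with hn | ⟨k, hn⟩
      · rcases hn fun k => (args k).eval μ with h | h
        · simpa [Expr.eval, h] using h0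
        · have h1 : wordOne ∈ C := hu 1 hM
          simpa [Expr.eval, h] using h1
      · exact hC _ (ih k (hτ.trans (hle k))) _ (hn _)
    · omega
  | @declass e₁ e₂ τ₁ τ _ h₂ _ _ _ _ =>
    have := h₂.length_le_of_outermost hΔ (hj.trans hjo) (hi.trans hjo) hM hμ le_rfl
    exact hu _ (by omega)

/-- The total additive constant of the positive operators on a branch of an expression. -/
noncomputable def Expr.growth : Expr S V → ℕ
  | .var _ => 0
  | .op o args => (Finset.univ.sup fun i => (args i).growth) +
      open Classical in if h : IsPositive (S.sem o) then h.choose else 0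
  | .declass _ _ => 0

omit [BitAlphabet A] in
theorem maxLength_le {n : ℕ} {w : Fin n → Word A} {B : ℕ} (h : ∀ k, (w k).length ≤ B) :
    maxLength w ≤ B :=
  Finset.sup_le fun k _ => h k

/-- Inside loops, evaluating an expression adds at most a constant to the lengths of the variables
of at least its level. -/
theorem ExprTyped.length_le_growth {Γ : VarEnv V} {Δ : OpEnv S} (hΔ : Δ.Safe)
    {i o τ M B : ℕ} {e : Expr S V} {μ : Store A V} (h : ExprTyped Γ Δ i o e τ)
    (ho : 1 ≤ o) (hio : i ≤ o) (hM : 1 ≤ M) (hMB : M ≤ B) (hμ : BoundedFrom Γ o M μ)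
    (hB : BoundedFrom Γ τ B μ) : (e.eval μ).length ≤ B + e.growth := by
  induction h with
  | var hx => exact hB _ _ hx le_rfl
  | @op f args τ τ' hf ht _ ih =>
    obtain ⟨hle, hn⟩ := hΔ.neutral_or_positive hf ht ho
    have ih (k) : ((args k).eval μ).length ≤ B + Finset.univ.sup fun i => (args i).growth := by
      have h₁ := ih k (hB.mono (hle k) le_rfl)
      have h₂ := Finset.le_sup (f := fun i => (args i).growth) (Finset.mem_univ k)
      exact h₁.trans (by simpa using h₂)
    simp only [Expr.growth, Expr.eval]
    rcases hn with (hn | ⟨k, hn⟩) | ⟨hp, -⟩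
    · rcases hn fun k => (args k).eval μ with h | h <;> simp [h, wordZero, wordOne] <;> omega
    · have := ih k
      have := (hn fun k => (args k).eval μ).length_le
      omega
    · rw [dif_pos hp]
      have h₁ := hp.choose_spec fun k => (args k).eval μ
      have h₂ := maxLength_le ih
      omega
  | @declass e₁ e₂ τ₁ τ _ h₂ _ _ _ _ =>
    have := h₂.length_le_of_outermost hΔ ho hio hM hμ le_rfl
    simp only [Expr.eval, unary, List.length_replicate]
    omega

/-- The undeclassified variables of an expression have at least its level. -/
theorem ExprTyped.level_of_undeclassified {Γ : VarEnv V} {Δ : OpEnv S} (hΔ : Δ.Safe)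
    {i o τ : ℕ} {e : Expr S V} (h : ExprTyped Γ Δ i o e τ) (ho : 1 ≤ o) {x : V}
    (hx : x ∈ e.undeclassified) : ∃ l, Γ x = some l ∧ τ ≤ l := by
  induction h with
  | @var y τ hy => exact ⟨τ, by simp_all [Expr.undeclassified], le_rfl⟩
  | @op f args τ τ' hf ht _ ih =>
    obtain ⟨k, hk⟩ := Set.mem_iUnion.1 (by simpa only [Expr.undeclassified] using hx)
    obtain ⟨l, hl, hle⟩ := ih k hk
    exact ⟨l, hl, ((hΔ.neutral_or_positive hf ht ho).1 k).trans hle⟩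
  | declass _ _ _ hτ _ ih₂ =>
    obtain ⟨l, hl, hle⟩ := ih₂ hx
    exact ⟨l, hl, hτ.trans hle⟩

end Expressions

/-! ### Traces of levelled statements -/

section Traces

variable {A : Type} [BitAlphabet A] {S : Operators.{u} A} {V : Type v}

/-- Statements whose loops are annotated by their level. -/
inductive LStmt {A : Type} (S : Operators.{u} A) (V : Type v) : Type (max u v)
  | skip : LStmt S V
  | assign (x : V) (e : Expr S V) : LStmt S V
  | seq (s₁ s₂ : LStmt S V) : LStmt S V
  | ite (e : Expr S V) (s₁ s₀ : LStmt S V) : LStmt S V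
  | loop (τ : ℕ) (e : Expr S V) (s : LStmt S V) : LStmt S V
  | brk (e : Expr S V) : LStmt S V

/-- The statement obtained by forgetting the levels of the loops. -/
def LStmt.erase : LStmt S V → Stmt S V
  | .skip => .skip
  | .assign x e => .assign x e
  | .seq s₁ s₂ => .seq s₁.erase s₂.erase
  | .ite e s₁ s₀ => .ite e s₁.erase s₀.erase
  | .loop _ e s => .loop e s.erase
  | .brk e => .brk e

/-- `Leveled Γ Δ o i s`: the levels of the loops of `s` witness that `s` is typable inside a loop
of level `i` and an outermost loop of level `o`. The types of statements are recorded only through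
their consequence that in a loop of level `i` all assigned variables and all loops have level at
most `i`. -/
def Leveled (Γ : VarEnv V) (Δ : OpEnv S) (o : ℕ) : ℕ → LStmt S V → Prop
  | _, .skip => True
  | i, .assign x e => ∃ τ₁ τ₂, Γ x = some τ₁ ∧ ExprTyped Γ Δ i o e τ₂ ∧ τ₁ ≤ τ₂ ∧ τ₁ ≤ i
  | i, .seq s₁ s₂ => Leveled Γ Δ o i s₁ ∧ Leveled Γ Δ o i s₂
  | i, .ite e s₁ s₀ => (∃ τ, ExprTyped Γ Δ i o e τ) ∧ Leveled Γ Δ o i s₁ ∧ Leveled Γ Δ o i s₀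
  | i, .loop τ e s => 1 ≤ τ ∧ τ ≤ i ∧ ExprTyped Γ Δ τ o e τ ∧ Leveled Γ Δ o τ s
  | i, .brk e => ∃ τ, ExprTyped Γ Δ i o e τ

omit [BitAlphabet A] in
theorem StmtTyped.exists_leveled {Γ : VarEnv V} {Δ : OpEnv S} {i o τ : ℕ} {s : Stmt S V}
    (h : StmtTyped Γ Δ i o s τ) (ho : 1 ≤ o) (hτ : τ ≤ i) :
    ∃ a : LStmt S V, a.erase = s ∧ Leveled Γ Δ o i a := by
  induction h with
  | sub _ hle ih => exact ih ho (hle.trans hτ)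
  | skip => exact ⟨.skip, rfl, trivial⟩
  | @assign i o x e τ₁ τ₂ hx he hor =>
    exact ⟨.assign x e, rfl, τ₁, τ₂, hx, he, by omega, hτ⟩
  | seq _ _ ih₁ ih₂ =>
    obtain ⟨a₁, rfl, h₁⟩ := ih₁ ho hτ
    obtain ⟨a₂, rfl, h₂⟩ := ih₂ ho hτ
    exact ⟨.seq a₁ a₂, rfl, h₁, h₂⟩
  | @ite i o e _ _ τ he _ _ ih₁ ih₂ =>
    obtain ⟨a₁, rfl, h₁⟩ := ih₁ ho hτ
    obtain ⟨a₂, rfl, h₂⟩ := ih₂ ho hτ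
    exact ⟨.ite e a₁ a₂, rfl, ⟨τ, he⟩, h₁, h₂⟩
  | @loop_inner i o e _ τ he _ h₁ _ ih =>
    obtain ⟨a, rfl, h⟩ := ih ho le_rfl
    exact ⟨.loop τ e a, rfl, h₁, hτ, he, h⟩
  | loop_outer => omega
  | @brk i o e τ he _ => exact ⟨.brk e, rfl, τ, he⟩

variable [DecidableEq V]

/-- `Trace i μ s b μ' t`: the statement `s`, started in the store `μ` inside a loop of level `i`,
terminates with the flag `b` in the store `μ'`, and `t` lists its elementary steps, each one with
the level of the innermost loop around it and with the store before it. The evaluation of the guard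
of a loop counts as a step inside the loop. -/
inductive Trace : ℕ → Store A V → LStmt S V → Flag → Store A V → List (ℕ × Store A V) → Prop
  | skip (i μ) : Trace i μ .skip .cont μ [(i, μ)]
  | assign (i μ x) (e : Expr S V) :
      Trace i μ (.assign x e) .cont (Function.update μ x (e.eval μ)) [(i, μ)]
  | seq {i μ μ' μ'' s₁ s₂ b t₁ t₂} :
      Trace i μ s₁ .cont μ' t₁ → Trace i μ' s₂ b μ'' t₂ → Trace i μ (.seq s₁ s₂) b μ'' (t₁ ++ t₂)
  | seq_broken {i μ μ' s₁ s₂ t} :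
      Trace i μ s₁ .broken μ' t → Trace i μ (.seq s₁ s₂) .broken μ' t
  | ite_true {i μ μ' e s₁ s₀ b t} :
      e.eval μ = wordOne → Trace i μ s₁ b μ' t → Trace i μ (.ite e s₁ s₀) b μ' ((i, μ) :: t)
  | ite_false {i μ μ' e s₁ s₀ b t} :
      e.eval μ ≠ wordOne → Trace i μ s₀ b μ' t → Trace i μ (.ite e s₁ s₀) b μ' ((i, μ) :: t)
  | loop_false {i μ τ e s} :
      e.eval μ ≠ wordOne → Trace i μ (.loop τ e s) .cont μ [(τ, μ)]
  | loop_true {i μ μ' μ'' τ e s t₁ t₂} :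
      e.eval μ = wordOne → Trace τ μ s .cont μ' t₁ → Trace i μ' (.loop τ e s) .cont μ'' t₂ →
      Trace i μ (.loop τ e s) .cont μ'' ((τ, μ) :: (t₁ ++ t₂))
  | loop_broken {i μ μ' τ e s t} :
      e.eval μ = wordOne → Trace τ μ s .broken μ' t →
      Trace i μ (.loop τ e s) .cont μ' ((τ, μ) :: t)
  | brk_false {i μ e} : e.eval μ ≠ wordOne → Trace i μ (.brk e) .cont μ [(i, μ)]
  | brk_true {i μ e} : e.eval μ = wordOne → Trace i μ (.brk e) .broken μ [(i, μ)]

theorem Trace.eval {i : ℕ} {μ μ' : Store A V} {a : LStmt S V} {b : Flag}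
    {t : List (ℕ × Store A V)} (h : Trace i μ a b μ' t) : Eval μ a.erase b μ' := by
  induction h with
  | skip => exact .skip _
  | assign => exact .assign _ _ _
  | seq _ _ ih₁ ih₂ => exact .seq ih₁ ih₂
  | seq_broken _ ih => exact .seq_broken ih
  | ite_true he _ ih => exact .ite_true he ih
  | ite_false he _ ih => exact .ite_false he ih
  | loop_false he => exact .loop_false he
  | loop_true he _ _ ih₁ ih₂ => exact .loop_true he (.seq ih₁ ih₂)
  | loop_broken he _ ih => exact .loop_true he (.seq_broken ih)
  | brk_false he => exact .brk_false he
  | brk_true he => exact .brk_true he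

theorem Trace.length_pos {i : ℕ} {μ μ' : Store A V} {a : LStmt S V} {b : Flag}
    {t : List (ℕ × Store A V)} (h : Trace i μ a b μ' t) : 1 ≤ t.length := by
  induction h <;> (simp_all; try omega)

theorem Trace.level_mem {Γ : VarEnv V} {Δ : OpEnv S} {o i : ℕ} {μ μ' : Store A V} {a : LStmt S V}
    {b : Flag} {t : List (ℕ × Store A V)} (h : Trace i μ a b μ' t) (ha : Leveled Γ Δ o i a)
    (hi : 1 ≤ i) : ∀ p ∈ t, 1 ≤ p.1 ∧ p.1 ≤ i := by
  induction h with
  | skip | assign | brk_false | brk_true => simpa using hi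
  | seq _ _ ih₁ ih₂ =>
    intro p hp
    exact (List.mem_append.1 hp).elim (ih₁ ha.1 hi p) (ih₂ ha.2 hi p)
  | seq_broken _ ih => exact ih ha.1 hi
  | ite_true _ _ ih => exact List.forall_mem_cons.2 ⟨⟨hi, le_rfl⟩, ih ha.2.1 hi⟩
  | ite_false _ _ ih => exact List.forall_mem_cons.2 ⟨⟨hi, le_rfl⟩, ih ha.2.2 hi⟩
  | loop_false => simpa using ⟨ha.1, ha.2.1⟩
  | loop_true _ _ _ ih₁ ih₂ =>
    refine List.forall_mem_cons.2 ⟨⟨ha.1, ha.2.1⟩, fun p hp => ?_⟩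
    rcases List.mem_append.1 hp with hp | hp
    · exact ⟨(ih₁ ha.2.2.2 ha.1 p hp).1, (ih₁ ha.2.2.2 ha.1 p hp).2.trans ha.2.1⟩
    · exact ih₂ ha hi p hp
  | loop_broken _ _ ih =>
    refine List.forall_mem_cons.2 ⟨⟨ha.1, ha.2.1⟩, fun p hp => ?_⟩
    exact ⟨(ih ha.2.2.2 ha.1 p hp).1, (ih ha.2.2.2 ha.1 p hp).2.trans ha.2.1⟩

/-- An invariant of all assignments in loops of level at most `i` holds throughout a trace. -/
theorem Trace.invariant {Γ : VarEnv V} {Δ : OpEnv S} {o i : ℕ} {μ μ' : Store A V} {a : LStmt S V}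
    {b : Flag} {t : List (ℕ × Store A V)} (h : Trace i μ a b μ' t) (ha : Leveled Γ Δ o i a)
    {I : Store A V → Prop}
    (hI : ∀ i' ≤ i, ∀ (ν : Store A V) x e τ₁ τ₂, I ν → Γ x = some τ₁ →
      ExprTyped Γ Δ i' o e τ₂ → τ₁ ≤ τ₂ → τ₁ ≤ i' → I (Function.update ν x (e.eval ν)))
    (hμ : I μ) : I μ' ∧ ∀ p ∈ t, I p.2 := by
  induction h with
  | skip | brk_false | brk_true | loop_false => simpa using hμ
  | assign i ν x e =>
    obtain ⟨τ₁, τ₂, h₁, h₂, h₃, h₄⟩ := ha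
    exact ⟨hI i le_rfl _ _ _ _ _ hμ h₁ h₂ h₃ h₄, by simpa using hμ⟩
  | seq _ _ ih₁ ih₂ =>
    obtain ⟨h₁, h₁'⟩ := ih₁ ha.1 hI hμ
    obtain ⟨h₂, h₂'⟩ := ih₂ ha.2 hI h₁
    exact ⟨h₂, fun p hp => (List.mem_append.1 hp).elim (h₁' p) (h₂' p)⟩
  | seq_broken _ ih => exact ih ha.1 hI hμ
  | ite_true _ _ ih =>
    obtain ⟨h₁, h₂⟩ := ih ha.2.1 hI hμ
    exact ⟨h₁, List.forall_mem_cons.2 ⟨hμ, h₂⟩⟩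
  | ite_false _ _ ih =>
    obtain ⟨h₁, h₂⟩ := ih ha.2.2 hI hμ
    exact ⟨h₁, List.forall_mem_cons.2 ⟨hμ, h₂⟩⟩
  | loop_true _ _ _ ih₁ ih₂ =>
    obtain ⟨h₁, h₁'⟩ := ih₁ ha.2.2.2 (fun i' hi' => hI i' (hi'.trans ha.2.1)) hμ
    obtain ⟨h₂, h₂'⟩ := ih₂ ha hI h₁
    exact ⟨h₂, List.forall_mem_cons.2 ⟨hμ,
      fun p hp => (List.mem_append.1 hp).elim (h₁' p) (h₂' p)⟩⟩
  | loop_broken _ _ ih =>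
    obtain ⟨h₁, h₁'⟩ := ih ha.2.2.2 (fun i' hi' => hI i' (hi'.trans ha.2.1)) hμ
    exact ⟨h₁, List.forall_mem_cons.2 ⟨hμ, h₁'⟩⟩

/-- The variables of level at least `o` do not get longer than `M`, and those of level at least `j`
have values in `C`. -/
def ValuesIn (Γ : VarEnv V) (o M j : ℕ) (C : Set (Word A)) (μ : Store A V) : Prop :=
  BoundedFrom Γ o M μ ∧ ∀ x l, Γ x = some l → j ≤ l → μ x ∈ C

theorem Trace.valuesIn {Γ : VarEnv V} {Δ : OpEnv S} (hΔ : Δ.Safe) {o i j M : ℕ} {μ μ' : Store A V}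
    {a : LStmt S V} {b : Flag} {t : List (ℕ × Store A V)} (h : Trace i μ a b μ' t)
    (ha : Leveled Γ Δ o i a) (hi : i ≤ j) (hj : 1 ≤ j) (hjo : j ≤ o) (hM : 1 ≤ M)
    {C : Set (Word A)} (hC : ∀ u ∈ C, ∀ v, v <:+: u → v ∈ C) (h0 : wordZero ∈ C)
    (hu : ∀ k ≤ M, unary k ∈ C) (hμ : ValuesIn Γ o M j C μ) :
    ValuesIn Γ o M j C μ' ∧ ∀ p ∈ t, ValuesIn Γ o M j C p.2 := by
  refine h.invariant ha (fun i' hi' ν x e τ₁ τ₂ hν hx he h₁ h₂ => ⟨fun y l hy hl => ?_,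
    fun y l hy hl => ?_⟩) hμ
  · obtain rfl | hxy := eq_or_ne y x
    · rw [Function.update_self]
      obtain rfl : τ₁ = l := by simpa [hx] using hy
      exact he.length_le_of_outermost hΔ (hj.trans hjo) (by omega) hM hν.1 (by omega)
    · rw [Function.update_of_ne hxy]
      exact hν.1 y l hy hl
  · obtain rfl | hxy := eq_or_ne y x
    · rw [Function.update_self]
      obtain rfl : τ₁ = l := by simpa [hx] using hy
      exact he.eval_mem hΔ (by omega) hj hjo hM hν.1 hC h0 hu hν.2 (by omega)
    · rw [Function.update_of_ne hxy]
      exact hν.2 y l hy hl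

theorem Trace.boundedFrom_outermost {Γ : VarEnv V} {Δ : OpEnv S} (hΔ : Δ.Safe) {o i M : ℕ}
    {μ μ' : Store A V} {a : LStmt S V} {b : Flag} {t : List (ℕ × Store A V)}
    (h : Trace i μ a b μ' t) (ha : Leveled Γ Δ o i a) (hi : 1 ≤ i) (hio : i ≤ o) (hM : 1 ≤ M)
    (hμ : BoundedFrom Γ o M μ) : BoundedFrom Γ o M μ' ∧ ∀ p ∈ t, BoundedFrom Γ o M p.2 := by
  obtain ⟨h₁, h₂⟩ := h.valuesIn hΔ ha hio (hi.trans hio) le_rfl hM (C := {u | u.length ≤ M})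
    (fun u hu v hv => hv.length_le.trans hu) (by simpa [wordZero] using hM)
    (fun k hk => by simpa [unary] using hk) ⟨hμ, hμ⟩
  exact ⟨h₁.1, fun p hp => (h₂ p hp).1⟩

/-- A constant bounding the growth in every assignment of a statement. -/
noncomputable def LStmt.growth : LStmt S V → ℕ
  | .assign _ e => e.growth
  | .seq s₁ s₂ => max s₁.growth s₂.growth
  | .ite _ s₁ s₀ => max s₁.growth s₀.growth
  | .loop _ _ s => s.growth
  | _ => 0

/-- The number of steps of a trace inside loops of level at least `j`. -/
def stepsFrom (j : ℕ) (t : List (ℕ × Store A V)) : ℕ := t.countP fun p => j ≤ p.1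

omit [BitAlphabet A] [DecidableEq V] in
theorem stepsFrom_cons (j : ℕ) (p : ℕ × Store A V) (t : List (ℕ × Store A V)) :
    stepsFrom j (p :: t) = stepsFrom j t + if j ≤ p.1 then 1 else 0 := by
  simp [stepsFrom, List.countP_cons]

omit [BitAlphabet A] [DecidableEq V] in
theorem stepsFrom_append (j : ℕ) (t₁ t₂ : List (ℕ × Store A V)) :
    stepsFrom j (t₁ ++ t₂) = stepsFrom j t₁ + stepsFrom j t₂ := by
  simp [stepsFrom]

/-- The variables of level at least `j` grow only in steps in loops of level greater than `j`, as an
assignment to a variable of the level of the innermost loop can only use neutral operators. -/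
theorem Trace.length_le {Γ : VarEnv V} {Δ : OpEnv S} (hΔ : Δ.Safe) {o i j M B c : ℕ}
    {μ μ' : Store A V} {a : LStmt S V} {b : Flag} {t : List (ℕ × Store A V)}
    (h : Trace i μ a b μ' t) (ha : Leveled Γ Δ o i a) (hi : 1 ≤ i) (hio : i ≤ o) (hM : 1 ≤ M)
    (hMB : M ≤ B) (hμ : BoundedFrom Γ o M μ) (hB : BoundedFrom Γ j B μ) (hc : a.growth ≤ c) :
    BoundedFrom Γ j (B + c * stepsFrom (j + 1) t) μ' ∧
      ∀ p ∈ t, BoundedFrom Γ j (B + c * stepsFrom (j + 1) t) p.2 := by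
  induction h generalizing B with
  | skip | brk_false | brk_true | loop_false =>
    simpa using hB.mono le_rfl (by omega)
  | assign i ν x e =>
    refine ⟨fun y l hy hl => ?_, by simpa using hB.mono le_rfl (by omega)⟩
    obtain rfl | hxy := eq_or_ne y x
    · obtain ⟨τ₁, τ₂, h₁, h₂, h₃, h₄⟩ := ha
      rw [Function.update_self]
      obtain rfl : τ₁ = l := by simpa [h₁] using hy
      by_cases hj : j + 1 ≤ i
      · have := h₂.length_le_growth hΔ (hi.trans hio) hio hM hMB hμ (hB.mono (by omega) le_rfl)
        have hc : e.growth ≤ c := hc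
        simp only [stepsFrom, List.countP_singleton, hj, decide_true, if_true]
        omega
      · have hji : j = i := by omega
        subst hji
        have := h₂.eval_mem hΔ le_rfl hi hio hM hμ (C := {u | u.length ≤ B})
          (fun u hu v hv => hv.length_le.trans hu) (by simpa [wordZero] using hM.trans hMB)
          (fun k hk => by simpa [unary] using hk.trans hMB) hB (by omega)
        exact le_add_right this
    · rw [Function.update_of_ne hxy]
      exact le_add_right (hB y l hy hl)
  | seq h₁ _ ih₁ ih₂ =>
    rw [stepsFrom_append, mul_add, ← add_assoc]
    obtain ⟨hb, hb'⟩ := ih₁ ha.1 hi hio hMB hμ hB ((le_max_left _ _).trans hc)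
    obtain ⟨hb₂, hb₂'⟩ := ih₂ ha.2 hi hio (le_add_right hMB)
      (h₁.boundedFrom_outermost hΔ ha.1 hi hio hM hμ).1 hb ((le_max_right _ _).trans hc)
    refine ⟨hb₂, fun p hp => (List.mem_append.1 hp).elim (fun hp => ?_) (hb₂' p)⟩
    exact (hb' p hp).mono le_rfl (by omega)
  | seq_broken _ ih => exact ih ha.1 hi hio hMB hμ hB ((le_max_left _ _).trans hc)
  | ite_true _ _ ih =>
    rw [stepsFrom_cons]
    obtain ⟨hb, hb'⟩ := ih ha.2.1 hi hio hMB hμ hB ((le_max_left _ _).trans hc)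
    refine ⟨hb.mono le_rfl (by gcongr; omega), List.forall_mem_cons.2
      ⟨hB.mono le_rfl (by omega), fun p hp => (hb' p hp).mono le_rfl (by gcongr; omega)⟩⟩
  | ite_false _ _ ih =>
    rw [stepsFrom_cons]
    obtain ⟨hb, hb'⟩ := ih ha.2.2 hi hio hMB hμ hB ((le_max_right _ _).trans hc)
    refine ⟨hb.mono le_rfl (by gcongr; omega), List.forall_mem_cons.2
      ⟨hB.mono le_rfl (by omega), fun p hp => (hb' p hp).mono le_rfl (by gcongr; omega)⟩⟩
  | @loop_true _ ν _ _ τ _ _ t₁ t₂ _ h₁ _ ih₁ ih₂ =>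
    obtain ⟨hb, hb'⟩ := ih₁ ha.2.2.2 ha.1 (ha.2.1.trans hio) hMB hμ hB hc
    obtain ⟨hb₂, hb₂'⟩ := ih₂ ha hi hio (le_add_right hMB)
      (h₁.boundedFrom_outermost hΔ ha.2.2.2 ha.1 (ha.2.1.trans hio) hM hμ).1 hb hc
    have hle : B + c * stepsFrom (j + 1) t₁ + c * stepsFrom (j + 1) t₂ ≤
        B + c * stepsFrom (j + 1) ((τ, ν) :: (t₁ ++ t₂)) := by
      rw [stepsFrom_cons, stepsFrom_append, add_assoc, ← mul_add]
      exact Nat.add_le_add_left (Nat.mul_le_mul_left _ (by omega)) _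
    refine ⟨hb₂.mono le_rfl hle, List.forall_mem_cons.2 ⟨hB.mono le_rfl (by omega), fun p hp =>
      (List.mem_append.1 hp).elim (fun hp => (hb' p hp).mono le_rfl (by omega))
        fun hp => (hb₂' p hp).mono le_rfl hle⟩⟩
  | loop_broken _ _ ih =>
    rw [stepsFrom_cons]
    obtain ⟨hb, hb'⟩ := ih ha.2.2.2 ha.1 (ha.2.1.trans hio) hMB hμ hB hc
    refine ⟨hb.mono le_rfl (by gcongr; omega), List.forall_mem_cons.2
      ⟨hB.mono le_rfl (by omega), fun p hp => (hb' p hp).mono le_rfl (by gcongr; omega)⟩⟩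

end Traces

/-! ### Aperiodicity bounds the number of iterations -/

section Aperiodicity

variable {A : Type} [BitAlphabet A] {S : Operators.{u} A} {V : Type v} [DecidableEq V]

/-- Aperiodicity of the evaluation tree of a single configuration. -/
def AperiodicFrom (c : Store A V × Stmt S V) : Prop :=
  ∀ (μ' μ'' : Store A V) (e : Expr S V) (s : Stmt S V),
    Relation.ReflTransGen Child c (μ', .loop e s) →
    Relation.TransGen Child (μ', .loop e s) (μ'', .loop e s) → ¬ StoreEquiv e μ' μ''

theorem AperiodicFrom.of_child {c c' : Store A V × Stmt S V} (h : AperiodicFrom c)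
    (hc : Child c c') : AperiodicFrom c' :=
  fun _ _ _ _ h₁ h₂ => h _ _ _ _ (.head hc h₁) h₂

theorem Program.Aperiodic.aperiodicFrom {P : Program S V} (h : P.Aperiodic) (μ : Store A V) :
    AperiodicFrom (μ, P.body) :=
  fun μ' μ'' e s h₁ h₂ he => h μ ⟨μ', μ'', e, s, h₁, h₁.trans h₂.to_reflTransGen, h₂, he⟩

theorem AperiodicFrom.loop_body {μ : Store A V} {e : Expr S V} {s : Stmt S V}
    (h : AperiodicFrom (μ, .loop e s)) (he : e.eval μ = wordOne) : AperiodicFrom (μ, s) :=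
  (h.of_child (.loop s he)).of_child (.seq_left _ _ _)

theorem AperiodicFrom.loop_next {μ μ' : Store A V} {e : Expr S V} {s : Stmt S V}
    (h : AperiodicFrom (μ, .loop e s)) (he : e.eval μ = wordOne) (hs : Eval μ s .cont μ') :
    AperiodicFrom (μ', .loop e s) :=
  (h.of_child (.loop s he)).of_child (.seq_right _ hs)

/-- The stores `L`, the most recent one first, occur at successive iterations of one loop, and all
of them satisfy `I`. -/
def History (e : Expr S V) (s : Stmt S V) (I : Store A V → Prop) (L : List (Store A V)) : Prop :=
  L.Pairwise (fun μ' μ => Relation.TransGen Child (μ, .loop e s) (μ', .loop e s)) ∧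
    ∀ μ ∈ L, AperiodicFrom (μ, Stmt.loop e s) ∧ I μ

theorem History.cons {e : Expr S V} {s : Stmt S V} {I : Store A V → Prop} {L : List (Store A V)}
    {μ μ' : Store A V} (h : History e s I (μ :: L)) (he : e.eval μ = wordOne)
    (hs : Eval μ s .cont μ') (hI : I μ') : History e s I (μ' :: μ :: L) := by
  have hstep : Relation.TransGen Child (μ, Stmt.loop e s) (μ', Stmt.loop e s) :=
    .tail (.single (.loop s he)) (.seq_right _ hs)
  refine ⟨List.pairwise_cons.2 ⟨List.forall_mem_cons.2 ⟨hstep, fun ν hν => ?_⟩, h.1⟩,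
    List.forall_mem_cons.2 ⟨⟨(h.2 μ (by simp)).1.loop_next he hs, hI⟩, h.2⟩⟩
  exact ((List.pairwise_cons.1 h.1).1 ν hν).trans hstep

omit [BitAlphabet A] [DecidableEq V] in
/-- A word of length at most `B` has at most `(B + 1) ^ 2` subwords. -/
theorem exists_finset_subwords (T : Finset (Word A)) {B : ℕ} (hT : ∀ u ∈ T, u.length ≤ B) :
    ∃ F : Finset (Word A), F.card ≤ T.card * (B + 1) ^ 2 ∧ ∀ u ∈ T, ∀ v, v <:+: u → v ∈ F := by
  classical
  refine ⟨(T ×ˢ (Finset.range (B + 1) ×ˢ Finset.range (B + 1))).image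
    fun p => (p.1.drop p.2.1).take p.2.2, Finset.card_image_le.trans (by simp [sq]),
    fun u hu v hv => ?_⟩
  obtain ⟨a, b, rfl⟩ := hv
  have := hT _ hu
  simp only [List.length_append] at this
  refine Finset.mem_image.2 ⟨(a ++ v ++ b, a.length, v.length), ?_, by simp⟩
  simp only [Finset.mem_product, Finset.mem_range]
  exact ⟨hu, by omega, by omega⟩

/-- A bound on the number of different values of `m` variables that hold subwords of `m` words of
length at most `B`, truth values, or unary numbers of length at most `B`. -/
def iterationBound (m B : ℕ) : ℕ := ((m + 2) * (B + 1) ^ 2) ^ m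

/-- The words that the variables of level at least `j` may hold during a loop of level `j` started
in the store `μ`: the subwords of the words that they hold in `μ`, of the truth value `0`, and of
the unary number `M`; the truth value `1` is among the latter. -/
def reachableWords (Γ : VarEnv V) (j M : ℕ) (μ : Store A V) : Set (Word A) :=
  {u | u <:+: wordZero ∨ u <:+: unary M ∨ ∃ x l, Γ x = some l ∧ j ≤ l ∧ u <:+: μ x}

omit [DecidableEq V] in
theorem reachableWords_closed {Γ : VarEnv V} {j M : ℕ} {μ : Store A V} :
    ∀ u ∈ reachableWords Γ j M μ, ∀ v, v <:+: u → v ∈ reachableWords Γ j M μ := by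
  rintro u (h | h | ⟨x, l, hx, hl, h⟩) v hv
  exacts [.inl (hv.trans h), .inr (.inl (hv.trans h)), .inr (.inr ⟨x, l, hx, hl, hv.trans h⟩)]

omit [DecidableEq V] in
theorem unary_mem_reachableWords {Γ : VarEnv V} {j M : ℕ} {μ : Store A V} :
    ∀ k ≤ M, unary k ∈ reachableWords Γ j M μ := fun k hk =>
  .inr (.inl ⟨[], unary (M - k), by simp [unary, hk]⟩)

/-- The pigeonhole principle: by aperiodicity the stores of a history differ in an undeclassified
variable of the guard, and these variables hold reachable words only. -/
theorem History.length_le {Γ : VarEnv V} {Δ : OpEnv S} (hΔ : Δ.Safe) {X : Finset V}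
    (hX : ∀ x l, Γ x = some l → x ∈ X) {o τ M B : ℕ} {e : Expr S V} {s : Stmt S V}
    (he : ExprTyped Γ Δ τ o e τ) (ho : 1 ≤ o) (hM : 1 ≤ M) (hMB : M ≤ B) {μ₀ : Store A V}
    (hμ₀ : BoundedFrom Γ τ B μ₀) {L : List (Store A V)}
    (h : History e s (ValuesIn Γ o M τ (reachableWords Γ τ M μ₀)) L) :
    L.length ≤ iterationBound X.card B := by
  classical
  let T : Finset (Word A) :=
    insert wordZero (insert (unary M) ((X.filter fun x => ∃ l, Γ x = some l ∧ τ ≤ l).image μ₀))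
  have hT : ∀ u ∈ T, u.length ≤ B := by
    simp only [T, Finset.forall_mem_insert, Finset.forall_mem_image, Finset.mem_filter]
    refine ⟨by simp [wordZero]; omega, by simpa [unary] using hMB, ?_⟩
    rintro x ⟨-, l, hx, hl⟩
    exact hμ₀ x l hx hl
  have hTcard : T.card ≤ X.card + 2 := by
    refine (Finset.card_insert_le _ _).trans (Nat.succ_le_succ ((Finset.card_insert_le _ _).trans
      (Nat.succ_le_succ (Finset.card_image_le.trans (Finset.card_filter_le _ _)))))
  obtain ⟨F, hF, hTF⟩ := exists_finset_subwords T hT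
  have hCF : ∀ u ∈ reachableWords Γ τ M μ₀, u ∈ F := by
    rintro u (h | h | ⟨x, l, hx, hl, h⟩)
    · exact hTF _ (by simp [T]) u h
    · exact hTF _ (by simp [T]) u h
    · refine hTF (μ₀ x) (Finset.mem_insert_of_mem (Finset.mem_insert_of_mem ?_)) u h
      exact Finset.mem_image_of_mem _ (Finset.mem_filter.2 ⟨hX x l hx, l, hx, hl⟩)
  let g : Store A V → (X → Word A) := fun μ x => if (x : V) ∈ e.undeclassified then μ x else []
  have hnodup : (L.map g).Nodup := by
    rw [List.Nodup, List.pairwise_map]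
    refine h.1.imp_of_mem fun {μ' μ} hμ' hμ hstep heq => ?_
    refine (h.2 μ hμ).1 _ _ _ _ .refl hstep fun x hx => ?_
    obtain ⟨l, hl, -⟩ := he.level_of_undeclassified hΔ ho hx
    have := congrFun heq ⟨x, hX x l hl⟩
    simpa [g, hx] using this.symm
  have hsub : (L.map g).toFinset ⊆ Fintype.piFinset fun _ : X => F := by
    intro f hf
    obtain ⟨μ, hμ, rfl⟩ := List.mem_map.1 (List.mem_toFinset.1 hf)
    refine Fintype.mem_piFinset.2 fun x => hCF _ ?_
    by_cases hx : (x : V) ∈ e.undeclassified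
    · obtain ⟨l, hl, hle⟩ := he.level_of_undeclassified hΔ ho hx
      simpa [g, hx] using (h.2 μ hμ).2.2 x l hl hle
    · exact .inl (by simp [g, hx])
  have := Finset.card_le_card hsub
  rw [List.toFinset_card_of_nodup hnodup, List.length_map] at this
  refine this.trans ?_
  simp only [Fintype.card_piFinset, Finset.prod_const, Finset.card_univ, Fintype.card_coe]
  refine Nat.pow_le_pow_left (hF.trans ?_) _
  gcongr

/-- Inside loops every aperiodic evaluation terminates. -/
theorem Leveled.exists_trace {Γ : VarEnv V} {Δ : OpEnv S} (hΔ : Δ.Safe) {X : Finset V}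
    (hX : ∀ x l, Γ x = some l → x ∈ X) {o : ℕ} {a : LStmt S V} {i : ℕ} (ha : Leveled Γ Δ o i a)
    (hio : i ≤ o) (μ : Store A V) (hμ : AperiodicFrom (μ, a.erase)) :
    ∃ b μ' t, Trace i μ a b μ' t := by
  classical
  induction a generalizing i μ with
  | skip => exact ⟨_, _, _, .skip i μ⟩
  | assign x e => exact ⟨_, _, _, .assign i μ x e⟩
  | seq a₁ a₂ ih₁ ih₂ =>
    obtain ⟨b, μ', t₁, h₁⟩ := ih₁ ha.1 hio μ (hμ.of_child (.seq_left _ _ _))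
    cases b with
    | broken => exact ⟨_, _, _, .seq_broken h₁⟩
    | cont =>
      obtain ⟨b, μ'', t₂, h₂⟩ := ih₂ ha.2 hio μ' (hμ.of_child (.seq_right _ h₁.eval))
      exact ⟨_, _, _, .seq h₁ h₂⟩
  | ite e a₁ a₀ ih₁ ih₀ =>
    by_cases he : e.eval μ = wordOne
    · obtain ⟨b, μ', t, h⟩ := ih₁ ha.2.1 hio μ (hμ.of_child (.ite_true _ _ he))
      exact ⟨_, _, _, .ite_true he h⟩
    · obtain ⟨b, μ', t, h⟩ := ih₀ ha.2.2 hio μ (hμ.of_child (.ite_false _ _ he))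
      exact ⟨_, _, _, .ite_false he h⟩
  | brk e =>
    by_cases he : e.eval μ = wordOne
    exacts [⟨_, _, _, .brk_true he⟩, ⟨_, _, _, .brk_false he⟩]
  | loop τ e s ih =>
    obtain ⟨hτ, hτi, he, hs⟩ := ha
    obtain ⟨B, hB1, hB⟩ : ∃ B, 1 ≤ B ∧ BoundedFrom Γ 0 B μ :=
      ⟨(X.sup fun x => (μ x).length) + 1, by omega, fun x l hx _ =>
        le_add_right (Finset.le_sup (f := fun x => (μ x).length) (hX x l hx))⟩
    set C := reachableWords Γ τ B μ
    suffices H : ∀ n L ν, History e s.erase (ValuesIn Γ o B τ C) (ν :: L) →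
        iterationBound X.card B ≤ L.length + n → ∃ μ' t, Trace i ν (.loop τ e s) .cont μ' t by
      obtain ⟨μ', t, h⟩ := H (iterationBound X.card B) [] μ ⟨by simp, by
        simpa using ⟨hμ, hB.mono (by omega) le_rfl, fun x l hx hl =>
          .inr (.inr ⟨x, l, hx, hl, List.infix_refl _⟩)⟩⟩ (by simp)
      exact ⟨_, _, _, h⟩
    intro n
    induction n with
    | zero =>
      intro L ν hL hn
      have := hL.length_le hΔ hX he (hτ.trans (hτi.trans hio)) hB1 le_rfl
        (hB.mono (by omega) le_rfl)
      simp only [List.length_cons] at this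
      omega
    | succ n ihn =>
      intro L ν hL hn
      obtain ⟨hνa, hνC⟩ := hL.2 ν (by simp)
      by_cases heν : e.eval ν = wordOne
      · obtain ⟨b, ν', t₁, h₁⟩ := ih hs (hτi.trans hio) ν (hνa.loop_body heν)
        cases b with
        | broken => exact ⟨_, _, .loop_broken heν h₁⟩
        | cont =>
          have hν' := (h₁.valuesIn hΔ hs le_rfl hτ (hτi.trans hio) hB1 reachableWords_closed
            (.inl (List.infix_refl _)) unary_mem_reachableWords hνC).1
          obtain ⟨μ', t₂, h₂⟩ := ihn (ν :: L) ν' (hL.cons heν h₁.eval hν')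
            (by simp only [List.length_cons]; omega)
          exact ⟨_, _, .loop_true heν h₁ h₂⟩
      · exact ⟨_, _, .loop_false heν⟩

theorem Trace.loop_level {i i' τ : ℕ} {μ μ' : Store A V} {e : Expr S V} {s : LStmt S V} {b : Flag}
    {t : List (ℕ × Store A V)} (h : Trace i μ (.loop τ e s) b μ' t) :
    Trace i' μ (.loop τ e s) b μ' t := by
  generalize hc : LStmt.loop τ e s = c at h
  induction h with
  | loop_false he => cases hc; exact .loop_false he
  | loop_true he h₁ _ _ ih => cases hc; exact .loop_true he h₁ (ih rfl)
  | loop_broken he h => cases hc; exact .loop_broken he h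
  | _ => cases hc

/-- A bound on the number of steps in loops of level at least `j`, in terms of the number `m` of
variables and of the maximal length `B` of the variables of level at least `j`. -/
def LStmt.stepBound (m j B : ℕ) : LStmt S V → ℕ
  | .seq s₁ s₂ => s₁.stepBound m j B + s₂.stepBound m j B
  | .ite _ s₁ s₀ => 1 + (s₁.stepBound m j B + s₀.stepBound m j B)
  | .loop τ _ s => if τ < j then 0 else iterationBound m B * (1 + s.stepBound m j B)
  | _ => 1

omit [BitAlphabet A] [DecidableEq V] in
theorem LStmt.stepBound_polynomial (m j : ℕ) (a : LStmt S V) :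
    ∃ p : Polynomial ℕ, ∀ B, a.stepBound m j B = p.eval B := by
  induction a with
  | skip | assign | brk => exact ⟨1, by simp [LStmt.stepBound]⟩
  | seq _ _ ih₁ ih₂ =>
    obtain ⟨p₁, h₁⟩ := ih₁
    obtain ⟨p₂, h₂⟩ := ih₂
    exact ⟨p₁ + p₂, by simp [LStmt.stepBound, h₁, h₂]⟩
  | ite _ _ _ ih₁ ih₂ =>
    obtain ⟨p₁, h₁⟩ := ih₁
    obtain ⟨p₂, h₂⟩ := ih₂
    exact ⟨1 + (p₁ + p₂), by simp [LStmt.stepBound, h₁, h₂]⟩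
  | loop τ _ _ ih =>
    obtain ⟨p, h⟩ := ih
    by_cases hτ : τ < j
    · exact ⟨0, by simp [LStmt.stepBound, hτ]⟩
    · exact ⟨((Polynomial.C m + 2) * (Polynomial.X + 1) ^ 2) ^ m * (1 + p), by
        simp [LStmt.stepBound, hτ, h, iterationBound]⟩

/-- If the variables of level at least `j` stay below the length `B`, the number of steps in loops
of level at least `j` is polynomial in `B`: the steps of a loop of lower level do not count, as its
body has lower levels only, and the others make at most `iterationBound` iterations. -/
theorem Trace.stepsFrom_le {Γ : VarEnv V} {Δ : OpEnv S} (hΔ : Δ.Safe) {X : Finset V}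
    (hX : ∀ x l, Γ x = some l → x ∈ X) {o j M B : ℕ} (hM : 1 ≤ M) (hMB : M ≤ B)
    {a : LStmt S V} {i : ℕ} {μ μ' : Store A V} {b : Flag} {t : List (ℕ × Store A V)}
    (h : Trace i μ a b μ' t) (ha : Leveled Γ Δ o i a) (hi : 1 ≤ i) (hio : i ≤ o)
    (hap : AperiodicFrom (μ, a.erase)) (hμ : BoundedFrom Γ o M μ)
    (ht : ∀ p ∈ t, BoundedFrom Γ j B p.2) :
    stepsFrom j t ≤ a.stepBound X.card j B := by
  have hsing (p : ℕ × Store A V) : stepsFrom j [p] ≤ 1 := by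
    exact List.countP_le_length (l := [p])
  induction a generalizing i μ μ' b t with
  | skip => cases h; exact hsing _
  | assign => cases h; exact hsing _
  | brk => cases h <;> exact hsing _
  | seq a₁ a₂ ih₁ ih₂ =>
    cases h with
    | seq h₁ h₂ =>
      rw [List.forall_mem_append] at ht
      rw [stepsFrom_append]
      exact Nat.add_le_add (ih₁ h₁ ha.1 hi hio (hap.of_child (.seq_left _ _ _)) hμ ht.1)
        (ih₂ h₂ ha.2 hi hio (hap.of_child (.seq_right _ h₁.eval))
          (h₁.boundedFrom_outermost hΔ ha.1 hi hio hM hμ).1 ht.2)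
    | seq_broken h₁ =>
      exact le_add_right (ih₁ h₁ ha.1 hi hio (hap.of_child (.seq_left _ _ _)) hμ ht)
  | ite e a₁ a₀ ih₁ ih₀ =>
    cases h with
    | ite_true he h =>
      rw [List.forall_mem_cons] at ht
      have := ih₁ h ha.2.1 hi hio (hap.of_child (.ite_true _ _ he)) hμ ht.2
      rw [stepsFrom_cons, LStmt.stepBound]
      split_ifs <;> omega
    | ite_false he h =>
      rw [List.forall_mem_cons] at ht
      have := ih₀ h ha.2.2 hi hio (hap.of_child (.ite_false _ _ he)) hμ ht.2
      rw [stepsFrom_cons, LStmt.stepBound]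
      split_ifs <;> omega
  | loop τ e s ih =>
    obtain ⟨hτ, hτi, he, hs⟩ := id ha
    rw [LStmt.stepBound]
    split_ifs with hj
    · -- all steps are in loops of level at most `τ`
      have hl := (h.loop_level (i' := τ)).level_mem (Γ := Γ) (Δ := Δ) (o := o)
        ⟨hτ, le_rfl, he, hs⟩ hτ
      rw [Nat.le_zero, stepsFrom, List.countP_eq_zero]
      intro p hp
      have := hl p hp
      simp
      omega
    have hμB : BoundedFrom Γ τ B μ := by
      have hmem : ∃ l, (l, μ) ∈ t := by cases h <;> simp
      obtain ⟨l, hl⟩ := hmem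
      exact (ht _ hl).mono (not_lt.1 hj) le_rfl
    set C := reachableWords Γ τ M μ
    set N := 1 + s.stepBound X.card j B
    -- the steps of the iterations so far are paid for by the length of the history
    suffices H : ∀ {i' c ν ν' b t}, Trace i' ν c b ν' t → c = .loop τ e s →
        (∀ p ∈ t, BoundedFrom Γ j B p.2) → ∀ L,
        History e s.erase (ValuesIn Γ o M τ C) (ν :: L) →
        stepsFrom j t + L.length * N ≤ iterationBound X.card B * N by
      simpa using H h rfl ht [] ⟨by simp, by
        simpa using ⟨hap, hμ, fun x l hx hl => .inr (.inr ⟨x, l, hx, hl, List.infix_refl _⟩)⟩⟩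
    clear h ht hμ hap
    intro i' c ν ν' b t h hc ht L hL
    have hlen {ν : Store A V} {L : List (Store A V)}
        (hL : History e s.erase (ValuesIn Γ o M τ C) (ν :: L)) :
        L.length * N + N ≤ iterationBound X.card B * N := by
      have := Nat.mul_le_mul_right N
        (hL.length_le hΔ hX he (hτ.trans (hτi.trans hio)) hM hMB hμB)
      rwa [List.length_cons, add_mul, one_mul] at this
    induction h generalizing L with
    | @loop_false _ ν =>
      cases hc
      have h₁ := hsing (τ, ν)
      have h₂ := hlen hL
      omega
    | loop_true heν h₁ _ _ ih₂ =>
      cases hc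
      obtain ⟨hνa, hνC⟩ := hL.2 _ (List.mem_cons_self)
      rw [List.forall_mem_cons, List.forall_mem_append] at ht
      have h₂ := ih h₁ hs hτ (hτi.trans hio) (hνa.loop_body heν) hνC.1 ht.2.1
      have hL' := hL.cons heν h₁.eval (h₁.valuesIn hΔ hs le_rfl hτ (hτi.trans hio) hM
        reachableWords_closed (.inl (List.infix_refl _)) unary_mem_reachableWords hνC).1
      have h₃ := ih₂ rfl ht.2.2 _ hL'
      rw [List.length_cons, add_mul, one_mul] at h₃
      rw [stepsFrom_cons, stepsFrom_append]
      split_ifs <;> omega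
    | loop_broken heν h₁ _ =>
      cases hc
      obtain ⟨hνa, hνC⟩ := hL.2 _ (List.mem_cons_self)
      rw [List.forall_mem_cons] at ht
      have h₂ := ih h₁ hs hτ (hτi.trans hio) (hνa.loop_body heν) hνC.1 ht.2
      have h₃ := hlen hL
      rw [stepsFrom_cons]
      split_ifs <;> omega
    | _ => cases hc

/-- An outermost loop makes polynomially many steps through stores of polynomial size. The levels
are treated from the top: polynomially many steps in loops of level greater than `j` let the
variables of level `j` grow polynomially only, which in turn bounds the number of steps in loops of
level `j`. -/
theorem Leveled.exists_polynomial {Γ : VarEnv V} {Δ : OpEnv S} (hΔ : Δ.Safe) {X : Finset V}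
    (hX : ∀ x l, Γ x = some l → x ∈ X) {o : ℕ} (ho : 1 ≤ o) {a : LStmt S V}
    (ha : Leveled Γ Δ o o a) :
    ∃ p q : Polynomial ℕ, ∀ N μ b μ' t, BoundedFrom Γ 0 N μ → AperiodicFrom (μ, a.erase) →
      Trace o μ a b μ' t → t.length ≤ p.eval N ∧ BoundedFrom Γ 0 (q.eval N) μ' ∧
        ∀ p ∈ t, BoundedFrom Γ 0 (q.eval N) p.2 := by
  have key : ∀ k ≤ o, ∃ p : Polynomial ℕ, ∀ N μ b μ' t, BoundedFrom Γ 0 N μ →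
      AperiodicFrom (μ, a.erase) → Trace o μ a b μ' t → stepsFrom (o + 1 - k) t ≤ p.eval N := by
    intro k
    induction k with
    | zero =>
      refine fun _ => ⟨0, fun N μ b μ' t _ _ h => ?_⟩
      rw [Polynomial.eval_zero, Nat.le_zero, stepsFrom, List.countP_eq_zero]
      intro p hp
      have := h.level_mem ha ho p hp
      simp
      omega
    | succ k ih =>
      intro hk
      obtain ⟨p, hp⟩ := ih (by omega)
      obtain ⟨q, hq⟩ := a.stepBound_polynomial X.card (o - k)
      refine ⟨q.comp (Polynomial.X + 1 + Polynomial.C a.growth * p),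
        fun N μ b μ' t hμ hap h => ?_⟩
      rw [show o + 1 - (k + 1) = o - k by omega]
      have h₁ := hp N μ b μ' t hμ hap h
      rw [show o + 1 - k = o - k + 1 by omega] at h₁
      have h₂ := (h.length_le hΔ (j := o - k) ha ho le_rfl (M := N + 1) (by omega) le_rfl
        (hμ.mono (by omega) (by omega)) (hμ.mono (by omega) (by omega)) le_rfl).2
      have h₃ := h.stepsFrom_le hΔ hX (M := N + 1) (B := N + 1 + a.growth * p.eval N) (by omega)
        (by omega) ha ho le_rfl hap (hμ.mono (by omega) (by omega))
        (fun r hr => (h₂ r hr).mono le_rfl (by gcongr))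
      simpa [hq] using h₃
  obtain ⟨p, hp⟩ := key o le_rfl
  refine ⟨p, Polynomial.X + 1 + Polynomial.C a.growth * p, fun N μ b μ' t hμ hap h => ?_⟩
  have h₁ := hp N μ b μ' t hμ hap h
  rw [show o + 1 - o = 0 + 1 by omega] at h₁
  have h₂ := h.length_le hΔ (j := 0) ha ho le_rfl (M := N + 1) (by omega) le_rfl
    (hμ.mono (by omega) (by omega)) (hμ.mono (by omega) (by omega)) le_rfl
  have hle : N + 1 + a.growth * stepsFrom (0 + 1) t ≤
      (Polynomial.X + 1 + Polynomial.C a.growth * p).eval N := by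
    simp only [Polynomial.eval_add, Polynomial.eval_X, Polynomial.eval_one, Polynomial.eval_mul,
      Polynomial.eval_C]
    gcongr
  refine ⟨?_, h₂.1.mono le_rfl hle, fun r hr => (h₂.2 r hr).mono le_rfl hle⟩
  convert h₁
  rw [stepsFrom, eq_comm, List.countP_eq_length]
  intro r hr
  simpa using (h.level_mem ha ho r hr).1

end Aperiodicity

/-! ### Safe programs run in polynomially many steps -/

section TopLevel

variable {A : Type} [BitAlphabet A] {S : Operators.{u} A} {V : Type v}

omit [BitAlphabet A] in
theorem IsPositive.isPolynomial {n : ℕ} {f : (Fin n → Word A) → Word A} (h : IsPositive f) :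
    IsPolynomial f := by
  obtain ⟨c, hc⟩ := h
  exact ⟨Polynomial.X + Polynomial.C c, by simpa using hc⟩

theorem IsNeutral.isPositive {n : ℕ} {f : (Fin n → Word A) → Word A} (h : IsNeutral f) :
    IsPositive f := by
  refine ⟨1, fun w => ?_⟩
  rcases h with h | ⟨i, h⟩
  · rcases h w with h | h <;> simp [h, wordZero, wordOne]
  · exact (h w).length_le.trans
      (le_add_right (Finset.le_sup (f := fun i => (w i).length) (Finset.mem_univ i)))

theorem OpEnv.Safe.isPolynomial {Δ : OpEnv S} (hΔ : Δ.Safe) {o : S.Op} (ho : o ∈ Δ.dom) :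
    IsPolynomial (S.sem o) :=
  (hΔ o ho).1.elim (fun h => h.isPositive.isPolynomial) fun h => h.elim (·.isPolynomial) id

theorem ExprTyped.exists_polynomial {Γ : VarEnv V} {Δ : OpEnv S} (hΔ : Δ.Safe) {i o τ : ℕ}
    {e : Expr S V} (h : ExprTyped Γ Δ i o e τ) :
    ∃ p : Polynomial ℕ, ∀ N μ, BoundedFrom Γ 0 N μ → (e.eval μ).length ≤ p.eval N := by
  induction h with
  | var hx => exact ⟨.X, fun N μ hμ => by simpa [Expr.eval] using hμ _ _ hx (Nat.zero_le _)⟩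
  | @op f args τ τ' hf _ _ ih =>
    choose p hp using ih
    obtain ⟨q, hq⟩ := hΔ.isPolynomial hf
    refine ⟨q.comp (∑ k, p k), fun N μ hμ => (hq _).trans ?_⟩
    rw [Polynomial.eval_comp]
    refine polynomial_eval_mono q (maxLength_le fun k => (hp k N μ hμ).trans ?_)
    rw [Polynomial.eval_finsetSum]
    exact Finset.single_le_sum (f := fun k => (p k).eval N) (fun _ _ => Nat.zero_le _)
      (Finset.mem_univ k)
  | declass _ _ _ _ ih _ =>
    obtain ⟨p, hp⟩ := ih
    refine ⟨p, fun N μ hμ => ?_⟩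
    simpa [Expr.eval, unary] using .inl (hp N μ hμ)

/-- All expressions of the statement are typable at some levels, and all assigned variables have
a type. -/
def LStmt.Supported (Γ : VarEnv V) (Δ : OpEnv S) : LStmt S V → Prop
  | .skip => True
  | .assign x e => (∃ τ, Γ x = some τ) ∧ ∃ i o τ, ExprTyped Γ Δ i o e τ
  | .seq s₁ s₂ => s₁.Supported Γ Δ ∧ s₂.Supported Γ Δ
  | .ite e s₁ s₀ => (∃ i o τ, ExprTyped Γ Δ i o e τ) ∧ s₁.Supported Γ Δ ∧ s₀.Supported Γ Δ
  | .loop _ e s => (∃ i o τ, ExprTyped Γ Δ i o e τ) ∧ s.Supported Γ Δ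
  | .brk e => ∃ i o τ, ExprTyped Γ Δ i o e τ

omit [BitAlphabet A] in
theorem Leveled.supported {Γ : VarEnv V} {Δ : OpEnv S} {o i : ℕ} {a : LStmt S V}
    (h : Leveled Γ Δ o i a) : a.Supported Γ Δ := by
  induction a generalizing i with
  | skip => trivial
  | assign x e =>
    obtain ⟨τ₁, τ₂, h₁, h₂, -, -⟩ := h
    exact ⟨⟨τ₁, h₁⟩, i, o, τ₂, h₂⟩
  | seq _ _ ih₁ ih₂ => exact ⟨ih₁ h.1, ih₂ h.2⟩
  | ite e _ _ ih₁ ih₂ => exact ⟨⟨i, o, h.1⟩, ih₁ h.2.1, ih₂ h.2.2⟩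
  | loop τ e _ ih => exact ⟨⟨τ, o, τ, h.2.2.1⟩, ih h.2.2.2⟩
  | brk e => exact ⟨i, o, h⟩

variable [DecidableEq V]

/-- A typable statement, started in any store from which it is aperiodic, terminates after
polynomially many steps through stores of polynomial size. -/
theorem StmtTyped.exists_trace {Γ : VarEnv V} {Δ : OpEnv S} (hΔ : Δ.Safe) {X : Finset V}
    (hX : ∀ x l, Γ x = some l → x ∈ X) {s : Stmt S V} {i o τ : ℕ} (h : StmtTyped Γ Δ i o s τ)
    (hi : i = 0) (ho : o = 0) :
    ∃ a : LStmt S V, a.erase = s ∧ a.Supported Γ Δ ∧ ∃ p q : Polynomial ℕ, ∀ N μ,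
      BoundedFrom Γ 0 N μ → AperiodicFrom (μ, s) → ∃ b μ' t, Trace 0 μ a b μ' t ∧
        t.length ≤ p.eval N ∧ BoundedFrom Γ 0 (q.eval N) μ' ∧
        ∀ r ∈ t, BoundedFrom Γ 0 (q.eval N) r.2 := by
  induction h with
  | sub _ _ ih => exact ih hi ho
  | skip => exact ⟨.skip, rfl, trivial, 1, .X, fun N μ hμ _ => ⟨_, _, _, .skip 0 μ, by simpa⟩⟩
  | @assign i o x e τ₁ τ₂ hx he _ =>
    obtain ⟨p, hp⟩ := he.exists_polynomial hΔ
    refine ⟨.assign x e, rfl, ⟨⟨τ₁, hx⟩, i, o, τ₂, he⟩, 1, .X + p, fun N μ hμ _ =>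
      ⟨_, _, _, .assign 0 μ x e, by simp, fun y l hy hl => ?_, by
        simpa using hμ.mono le_rfl (le_add_right le_rfl)⟩⟩
    rw [Polynomial.eval_add, Polynomial.eval_X]
    obtain rfl | hxy := eq_or_ne y x
    · rw [Function.update_self]
      exact le_add_left (hp N μ hμ)
    · rw [Function.update_of_ne hxy]
      exact le_add_right (hμ y l hy hl)
  | seq _ _ ih₁ ih₂ =>
    obtain ⟨a₁, rfl, hs₁, p₁, q₁, h₁⟩ := ih₁ hi ho
    obtain ⟨a₂, rfl, hs₂, p₂, q₂, h₂⟩ := ih₂ hi ho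
    refine ⟨.seq a₁ a₂, rfl, ⟨hs₁, hs₂⟩, p₁ + p₂.comp q₁, q₁ + q₂.comp q₁, fun N μ hμ hap => ?_⟩
    simp only [Polynomial.eval_add, Polynomial.eval_comp]
    obtain ⟨b, μ', t₁, ht₁, hp₁, hb₁, hr₁⟩ := h₁ N μ hμ (hap.of_child (.seq_left _ _ _))
    cases b with
    | broken =>
      exact ⟨_, _, _, .seq_broken ht₁, by omega, hb₁.mono le_rfl (by omega),
        fun r hr => (hr₁ r hr).mono le_rfl (by omega)⟩
    | cont =>
      obtain ⟨b, μ'', t₂, ht₂, hp₂, hb₂, hr₂⟩ :=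
        h₂ _ μ' hb₁ (hap.of_child (.seq_right _ ht₁.eval))
      exact ⟨_, _, _, .seq ht₁ ht₂, by simp only [List.length_append]; omega,
        hb₂.mono le_rfl (by omega), fun r hr => (List.mem_append.1 hr).elim
          (fun hr => (hr₁ r hr).mono le_rfl (by omega))
          fun hr => (hr₂ r hr).mono le_rfl (by omega)⟩
  | @ite i o e _ _ τ he _ _ ih₁ ih₂ =>
    obtain ⟨a₁, rfl, hs₁, p₁, q₁, h₁⟩ := ih₁ hi ho
    obtain ⟨a₂, rfl, hs₂, p₂, q₂, h₂⟩ := ih₂ hi ho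
    refine ⟨.ite e a₁ a₂, rfl, ⟨⟨i, o, τ, he⟩, hs₁, hs₂⟩, 1 + p₁ + p₂, .X + q₁ + q₂,
      fun N μ hμ hap => ?_⟩
    simp only [Polynomial.eval_add, Polynomial.eval_X, Polynomial.eval_one]
    by_cases heq : e.eval μ = wordOne
    · obtain ⟨b, μ', t, ht, hp, hb, hr⟩ := h₁ N μ hμ (hap.of_child (.ite_true _ _ heq))
      exact ⟨_, _, _, .ite_true heq ht, by simp only [List.length_cons]; omega,
        hb.mono le_rfl (by omega), List.forall_mem_cons.2 ⟨hμ.mono le_rfl (by omega),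
          fun r h => (hr r h).mono le_rfl (by omega)⟩⟩
    · obtain ⟨b, μ', t, ht, hp, hb, hr⟩ := h₂ N μ hμ (hap.of_child (.ite_false _ _ heq))
      exact ⟨_, _, _, .ite_false heq ht, by simp only [List.length_cons]; omega,
        hb.mono le_rfl (by omega), List.forall_mem_cons.2 ⟨hμ.mono le_rfl (by omega),
          fun r h => (hr r h).mono le_rfl (by omega)⟩⟩
  | loop_inner => omega
  | @loop_outer e _ τ he hs hτ _ =>
    obtain ⟨a, rfl, ha⟩ := hs.exists_leveled hτ le_rfl
    have hl : Leveled Γ Δ τ τ (.loop τ e a) := ⟨hτ, le_rfl, he, ha⟩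
    obtain ⟨p, q, h⟩ := hl.exists_polynomial hΔ hX hτ
    refine ⟨.loop τ e a, rfl, hl.supported, p, q, fun N μ hμ hap => ?_⟩
    obtain ⟨b, μ', t, ht⟩ := hl.exists_trace hΔ hX le_rfl μ hap
    exact ⟨b, μ', t, ht.loop_level, h N μ b μ' t hμ hap ht⟩
  | @brk i o e τ he _ =>
    refine ⟨.brk e, rfl, ⟨i, o, τ, he⟩, 1, .X, fun N μ hμ _ => ?_⟩
    by_cases heq : e.eval μ = wordOne
    exacts [⟨_, _, _, .brk_true heq, by simpa⟩, ⟨_, _, _, .brk_false heq, by simpa⟩]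

theorem Eval.deterministic {μ μ₁ μ₂ : Store A V} {s : Stmt S V} {b₁ b₂ : Flag}
    (h₁ : Eval μ s b₁ μ₁) (h₂ : Eval μ s b₂ μ₂) : b₁ = b₂ ∧ μ₁ = μ₂ := by
  induction h₁ generalizing b₂ μ₂ with
  | skip => cases h₂; exact ⟨rfl, rfl⟩
  | assign => cases h₂; exact ⟨rfl, rfl⟩
  | seq _ _ ih₁ ih₂ =>
    cases h₂ with
    | seq h h' => obtain ⟨-, rfl⟩ := ih₁ h; exact ih₂ h'
    | seq_broken h => cases (ih₁ h).1
  | seq_broken _ ih =>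
    cases h₂ with
    | seq h h' => cases (ih h).1
    | seq_broken h => exact ih h
  | ite_true he _ ih =>
    cases h₂ with
    | ite_true _ h => exact ih h
    | ite_false he' => exact absurd he he'
  | ite_false he _ ih =>
    cases h₂ with
    | ite_false _ h => exact ih h
    | ite_true he' => exact absurd he' he
  | loop_false he =>
    cases h₂ with
    | loop_false => exact ⟨rfl, rfl⟩
    | loop_true he' => exact absurd he' he
  | loop_true he _ ih =>
    cases h₂ with
    | loop_false he' => exact absurd he he'
    | loop_true _ h => exact ⟨rfl, (ih h).2⟩
  | brk_false he =>
    cases h₂ with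
    | brk_false => exact ⟨rfl, rfl⟩
    | brk_true he' => exact absurd he' he
  | brk_true he =>
    cases h₂ with
    | brk_false he' => exact absurd he he'
    | brk_true => exact ⟨rfl, rfl⟩

end TopLevel

/-! ### Program fragments of multi-stack machines -/

section Fragments

open Turing

variable {K : Type} {Γ : K → Type} {σ : Type}

/-- A program fragment of a multi-stack machine with the stacks `Γ` and the internal states `σ`:
halting means leaving the fragment. -/
structure Frag (Γ : K → Type) (σ : Type) where
  Λ : Type
  fin : Fintype Λ
  entry : Λ
  m : Λ → TM2.Stmt Γ Λ σ

/-- Redirect the labels of a machine statement along `φ`, and replace halting by a jump to `ex`,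
unless `ex` is `none`. -/
def relabel {Λ Λ' : Type} (φ : Λ → Λ') (ex : Option Λ') : TM2.Stmt Γ Λ σ → TM2.Stmt Γ Λ' σ
  | .push k f q => .push k f (relabel φ ex q)
  | .peek k f q => .peek k f (relabel φ ex q)
  | .pop k f q => .pop k f (relabel φ ex q)
  | .load f q => .load f (relabel φ ex q)
  | .branch p q₁ q₂ => .branch p (relabel φ ex q₁) (relabel φ ex q₂)
  | .goto f => .goto fun v => φ (f v)
  | .halt => ex.elim .halt fun l => .goto fun _ => l

/-- The effect of `relabel` on configurations. -/
def relabelCfg {Λ Λ' : Type} (φ : Λ → Λ') (ex : Option Λ') (c : TM2.Cfg Γ Λ σ) : TM2.Cfg Γ Λ' σ :=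
  ⟨c.l.elim ex fun l => some (φ l), c.var, c.stk⟩

/-- Translate a statement of a machine with the stacks `Γ ∘ ι` and the states `σ'` into a statement
of a machine with more stacks and with states in which those of `σ'` can be read and written. -/
def liftStmt {K' Λ σ' : Type} (ι : K' → K) (get : σ → σ') (set : σ' → σ → σ) :
    TM2.Stmt (fun k => Γ (ι k)) Λ σ' → TM2.Stmt Γ Λ σ
  | .push k f q => .push (ι k) (fun v => f (get v)) (liftStmt ι get set q)
  | .peek k f q => .peek (ι k) (fun v a => set (f (get v) a) v) (liftStmt ι get set q)
  | .pop k f q => .pop (ι k) (fun v a => set (f (get v) a) v) (liftStmt ι get set q)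
  | .load f q => .load (fun v => set (f (get v)) v) (liftStmt ι get set q)
  | .branch p q₁ q₂ =>
    .branch (fun v => p (get v)) (liftStmt ι get set q₁) (liftStmt ι get set q₂)
  | .goto f => .goto fun v => f (get v)
  | .halt => .halt

variable [DecidableEq K]

/-- `Reach M n c c'`: the machine `M` gets from the configuration `c` to `c'` in `n` steps. -/
inductive Reach {Λ : Type} (M : Λ → TM2.Stmt Γ Λ σ) :
    ℕ → TM2.Cfg Γ Λ σ → TM2.Cfg Γ Λ σ → Prop
  | refl (c) : Reach M 0 c c
  | head {n l v T c} : Reach M n (TM2.stepAux (M l) v T) c → Reach M (n + 1) ⟨some l, v, T⟩ c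

theorem Reach.trans {Λ : Type} {M : Λ → TM2.Stmt Γ Λ σ} {n₁ n₂ : ℕ} {c₁ c₂ c₃ : TM2.Cfg Γ Λ σ}
    (h₁ : Reach M n₁ c₁ c₂) (h₂ : Reach M n₂ c₂ c₃) : Reach M (n₁ + n₂) c₁ c₃ := by
  induction h₁ with
  | refl => simpa using h₂
  | head _ ih => rw [add_right_comm]; exact .head (ih h₂)

theorem stepAux_relabel {Λ Λ' : Type} (φ : Λ → Λ') (ex : Option Λ') (q : TM2.Stmt Γ Λ σ) (v : σ)
    (T : ∀ k, List (Γ k)) :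
    TM2.stepAux (relabel φ ex q) v T = relabelCfg φ ex (TM2.stepAux q v T) := by
  induction q generalizing v T with
  | push _ _ _ ih | peek _ _ _ ih | pop _ _ _ ih | load _ _ ih =>
    simp only [relabel, TM2.stepAux, ih]
  | branch p _ _ ih₁ ih₂ =>
    simp only [relabel, TM2.stepAux, ih₁, ih₂]
    cases p v <;> rfl
  | goto => rfl
  | halt => cases ex <;> rfl

theorem Reach.relabel {Λ Λ' : Type} {M : Λ → TM2.Stmt Γ Λ σ} {M' : Λ' → TM2.Stmt Γ Λ' σ}
    {φ : Λ → Λ'} {ex : Option Λ'} (hM : ∀ l, M' (φ l) = relabel φ ex (M l)) {n : ℕ}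
    {c c' : TM2.Cfg Γ Λ σ} (h : Reach M n c c') :
    Reach M' n (relabelCfg φ ex c) (relabelCfg φ ex c') := by
  induction h with
  | refl => exact .refl _
  | head _ ih => exact .head (by rw [hM, stepAux_relabel]; exact ih)

theorem stepAux_liftStmt {K' Λ σ' : Type} [DecidableEq K'] {ι : K' → K} {get : σ → σ'}
    {set : σ' → σ → σ} {var : σ' → σ} {stk : (∀ k, List (Γ (ι k))) → ∀ k, List (Γ k)}
    (hget : ∀ a, get (var a) = a) (hset : ∀ a b, set b (var a) = var b)
    (hstk : ∀ T k, stk T (ι k) = T k)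
    (hupd : ∀ T k x, Function.update (stk T) (ι k) x = stk (Function.update T k x))
    (q : TM2.Stmt (fun k => Γ (ι k)) Λ σ') (v : σ') (T : ∀ k, List (Γ (ι k))) :
    TM2.stepAux (liftStmt ι get set q) (var v) (stk T) =
      ⟨(TM2.stepAux q v T).l, var (TM2.stepAux q v T).var, stk (TM2.stepAux q v T).stk⟩ := by
  induction q generalizing v T with
  | push _ _ _ ih | peek _ _ _ ih | pop _ _ _ ih | load _ _ ih =>
    simp only [liftStmt, TM2.stepAux, hget, hset, hstk, hupd, ih]
  | branch p _ _ ih₁ ih₂ =>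
    simp only [liftStmt, TM2.stepAux, ih₁, ih₂, hget]
    cases p v <;> rfl
  | goto => simp only [liftStmt, TM2.stepAux, hget]
  | halt => rfl

theorem Reach.liftStmt {K' Λ σ' : Type} [DecidableEq K'] {ι : K' → K} {get : σ → σ'}
    {set : σ' → σ → σ} {var : σ' → σ} {stk : (∀ k, List (Γ (ι k))) → ∀ k, List (Γ k)}
    (hget : ∀ a, get (var a) = a) (hset : ∀ a b, set b (var a) = var b)
    (hstk : ∀ T k, stk T (ι k) = T k)
    (hupd : ∀ T k x, Function.update (stk T) (ι k) x = stk (Function.update T k x))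
    {M : Λ → TM2.Stmt (fun k => Γ (ι k)) Λ σ'} {n : ℕ} {c c' : TM2.Cfg (fun k => Γ (ι k)) Λ σ'}
    (h : Reach M n c c') :
    Reach (fun l => liftStmt ι get set (M l)) n ⟨c.l, var c.var, stk c.stk⟩
      ⟨c'.l, var c'.var, stk c'.stk⟩ := by
  induction h with
  | refl => exact .refl _
  | head _ ih => exact .head (by rwa [stepAux_liftStmt hget hset hstk hupd])

namespace Frag

/-- The fragment, entered with the internal state and the stacks `s`, is left with `s'` after at
most `n` steps. -/
def Runs (F : Frag Γ σ) (s s' : σ × ∀ k, List (Γ k)) (n : ℕ) : Prop :=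
  ∃ k ≤ n, Reach F.m k ⟨some F.entry, s.1, s.2⟩ ⟨none, s'.1, s'.2⟩

theorem Runs.mono {F : Frag Γ σ} {s s' : σ × ∀ k, List (Γ k)} {n n' : ℕ} (h : F.Runs s s' n)
    (hn : n ≤ n') : F.Runs s s' n' :=
  let ⟨k, hk, h⟩ := h
  ⟨k, hk.trans hn, h⟩

/-- A single machine statement that may jump back to its beginning. -/
def single (q : TM2.Stmt Γ Unit σ) : Frag Γ σ := ⟨Unit, inferInstance, (), fun _ => q⟩

theorem single_halt {q : TM2.Stmt Γ Unit σ} {v v' : σ} {T T' : ∀ k, List (Γ k)}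
    (h : TM2.stepAux q v T = ⟨none, v', T'⟩) : (single q).Runs (v, T) (v', T') 1 :=
  ⟨1, le_rfl, .head (by rw [single, h]; exact .refl _)⟩

theorem single_goto {q : TM2.Stmt Γ Unit σ} {v v' : σ} {T T' : ∀ k, List (Γ k)}
    (h : TM2.stepAux q v T = ⟨some (), v', T'⟩) {s : σ × ∀ k, List (Γ k)} {n : ℕ}
    (hs : (single q).Runs (v', T') s n) : (single q).Runs (v, T) s (n + 1) := by
  obtain ⟨k, hk, hs⟩ := hs
  exact ⟨k + 1, by omega, .head (by rw [single, h]; exact hs)⟩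

/-- Sequential composition. -/
def seq (F G : Frag Γ σ) : Frag Γ σ where
  Λ := F.Λ ⊕ G.Λ
  fin := let _ := F.fin; let _ := G.fin; inferInstance
  entry := .inl F.entry
  m := Sum.elim (fun l => relabel .inl (some (.inr G.entry)) (F.m l))
    fun l => relabel .inr none (G.m l)

theorem Runs.seq {F G : Frag Γ σ} {s₁ s₂ s₃ : σ × ∀ k, List (Γ k)} {n₁ n₂ : ℕ}
    (h₁ : F.Runs s₁ s₂ n₁) (h₂ : G.Runs s₂ s₃ n₂) : (F.seq G).Runs s₁ s₃ (n₁ + n₂) := by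
  obtain ⟨k₁, hk₁, h₁⟩ := h₁
  obtain ⟨k₂, hk₂, h₂⟩ := h₂
  exact ⟨k₁ + k₂, by omega, .trans (h₁.relabel (φ := Sum.inl) (ex := some (.inr G.entry))
    (M' := (F.seq G).m) fun _ => rfl)
    (h₂.relabel (φ := Sum.inr) (ex := none) (M' := (F.seq G).m) fun _ => rfl)⟩

/-- Conditional execution. -/
def ite (p : σ → Bool) (F G : Frag Γ σ) : Frag Γ σ where
  Λ := Option (F.Λ ⊕ G.Λ)
  fin := let _ := F.fin; let _ := G.fin; inferInstance
  entry := none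
  m
    | none => .branch p (.goto fun _ => some (.inl F.entry)) (.goto fun _ => some (.inr G.entry))
    | some (.inl l) => relabel (fun l => some (.inl l)) none (F.m l)
    | some (.inr l) => relabel (fun l => some (.inr l)) none (G.m l)

theorem Runs.ite_true {p : σ → Bool} {F : Frag Γ σ} (G : Frag Γ σ) {s s' : σ × ∀ k, List (Γ k)}
    {n : ℕ} (hp : p s.1 = true) (h : F.Runs s s' n) : (Frag.ite p F G).Runs s s' (n + 1) := by
  obtain ⟨k, hk, h⟩ := h
  refine ⟨k + 1, by omega, .head ?_⟩
  simp only [Frag.ite, TM2.stepAux, hp, cond_true]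
  exact h.relabel (φ := fun l => some (.inl l)) (ex := none) (M' := (Frag.ite p F G).m)
    fun _ => rfl

theorem Runs.ite_false {p : σ → Bool} (F : Frag Γ σ) {G : Frag Γ σ} {s s' : σ × ∀ k, List (Γ k)}
    {n : ℕ} (hp : p s.1 = false) (h : G.Runs s s' n) : (Frag.ite p F G).Runs s s' (n + 1) := by
  obtain ⟨k, hk, h⟩ := h
  refine ⟨k + 1, by omega, .head ?_⟩
  simp only [Frag.ite, TM2.stepAux, hp, cond_false]
  exact h.relabel (φ := fun l => some (.inr l)) (ex := none) (M' := (Frag.ite p F G).m)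
    fun _ => rfl

/-- Iteration. -/
def loop (p : σ → Bool) (F : Frag Γ σ) : Frag Γ σ where
  Λ := Option F.Λ
  fin := let _ := F.fin; inferInstance
  entry := none
  m
    | none => .branch p (.goto fun _ => some F.entry) .halt
    | some l => relabel some (some none) (F.m l)

theorem Runs.loop_false {p : σ → Bool} (F : Frag Γ σ) {s : σ × ∀ k, List (Γ k)}
    (hp : p s.1 = false) : (Frag.loop p F).Runs s s 1 := by
  refine ⟨1, le_rfl, .head ?_⟩
  simp only [Frag.loop, TM2.stepAux, hp, cond_false]
  exact .refl _

theorem Runs.loop_true {p : σ → Bool} {F : Frag Γ σ} {s s' s'' : σ × ∀ k, List (Γ k)}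
    {n n' : ℕ} (hp : p s.1 = true) (h : F.Runs s s' n) (h' : (Frag.loop p F).Runs s' s'' n') :
    (Frag.loop p F).Runs s s'' (n + n' + 1) := by
  obtain ⟨k, hk, h⟩ := h
  obtain ⟨k', hk', h'⟩ := h'
  refine ⟨k + k' + 1, by omega, .head ?_⟩
  simp only [Frag.loop, TM2.stepAux, hp, cond_true]
  exact .trans (h.relabel (φ := some) (ex := some none) (M' := (Frag.loop p F).m) fun _ => rfl) h'

end Frag

end Fragments

/-! ### The memory of the simulating machine -/

section Memory

open Turing

variable {A : Type} {m n : ℕ}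

/-- The stacks of the machine: one for each program variable, a work stack, two auxiliary stacks
and an output stack, and the stacks of the machines of all operators. -/
inductive Loc (m : ℕ) (M : Fin n → TM2ComputableAux (Option A) A) : Type
  | var (i : Fin m)
  | work
  | tmp
  | cnt
  | out
  | op (i : Fin n) (k : (M i).tm.K)

variable {M : Fin n → TM2ComputableAux (Option A) A}

noncomputable instance : DecidableEq (Loc m M) := Classical.decEq _

noncomputable instance : Fintype (Loc m M) :=
  let _ := fun i => (M i).tm.kFin
  Fintype.ofInjective
    (fun l : Loc m M => match l with
      | .var i => (Sum.inl (Sum.inl i) : (Fin m ⊕ Fin 4) ⊕ Σ i, (M i).tm.K)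
      | .work => .inl (.inr 0)
      | .tmp => .inl (.inr 1)
      | .cnt => .inl (.inr 2)
      | .out => .inl (.inr 3)
      | .op i k => .inr ⟨i, k⟩)
    (by rintro (_ | _ | _ | _ | _ | _) (_ | _ | _ | _ | _ | _) h <;> simp_all)

/-- The alphabets of the stacks. -/
abbrev Loc.Alph : Loc m M → Type
  | .var _ => Option A
  | .work => Option A
  | .tmp => Option A
  | .cnt => Option A
  | .out => A
  | .op i k => (M i).tm.Γ k

/-- The contents of the stacks. -/
@[ext]
structure Regs (m : ℕ) (M : Fin n → TM2ComputableAux (Option A) A) where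
  vars : Fin m → List (Option A)
  work : List (Option A)
  tmp : List (Option A)
  cnt : List (Option A)
  out : List A
  ops : ∀ (i : Fin n) (k : (M i).tm.K), List ((M i).tm.Γ k)

/-- The contents of the stacks as a function of the stack. -/
def Regs.stk (r : Regs m M) : ∀ l : Loc m M, List l.Alph
  | .var i => r.vars i
  | .work => r.work
  | .tmp => r.tmp
  | .cnt => r.cnt
  | .out => r.out
  | .op i k => r.ops i k

section Update

variable (r : Regs m M)

theorem Regs.update_var (i : Fin m) (x : List (Option A)) :
    Function.update r.stk (.var i) x = { r with vars := Function.update r.vars i x }.stk := by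
  funext l
  cases l with
  | var j => rcases eq_or_ne j i with rfl | h <;> simp [stk, *]
  | _ => simp [Function.update, stk]

theorem Regs.update_work (x : List (Option A)) :
    Function.update r.stk .work x = { r with work := x }.stk := by
  funext l
  cases l <;> simp [Function.update, stk]

theorem Regs.update_tmp (x : List (Option A)) :
    Function.update r.stk .tmp x = { r with tmp := x }.stk := by
  funext l
  cases l <;> simp [Function.update, stk]

theorem Regs.update_cnt (x : List (Option A)) :
    Function.update r.stk .cnt x = { r with cnt := x }.stk := by
  funext l
  cases l <;> simp [Function.update, stk]

theorem Regs.update_out (x : List A) :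
    Function.update r.stk .out x = { r with out := x }.stk := by
  funext l
  cases l <;> simp [Function.update, stk]

theorem Regs.update_op (i : Fin n) (k : (M i).tm.K)
    (x : List ((M i).tm.Γ k)) :
    Function.update r.stk (.op i k) x =
      { r with ops := Function.update r.ops i (Function.update (r.ops i) k x) }.stk := by
  funext l
  cases l with
  | op j k' =>
    by_cases h : j = i
    · subst h
      by_cases h : k' = k
      · subst h; simp [stk]
      · simp [stk, h]
    · simp [stk, h]
  | _ => simp [Function.update, stk]

end Update

/-- The internal states of the machine: a buffer for the symbol just read, the value of the last
test, whether the flow is being broken, and the states of the machines of the operators. -/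
@[ext]
structure Ctl (M : Fin n → TM2ComputableAux (Option A) A) where
  buf : Option (Option A)
  test : Bool
  broken : Bool
  sub : ∀ i, (M i).tm.σ

noncomputable instance [Fintype A] : Fintype (Ctl M) :=
  let _ := fun i => (M i).tm.σFin
  Fintype.ofInjective (fun c : Ctl M => (c.buf, c.test, c.broken, c.sub))
    fun c d h => by
      obtain ⟨h₁, h₂, h₃, h₄⟩ : _ ∧ _ ∧ _ ∧ _ := by simpa only [Prod.mk.injEq] using h
      exact Ctl.ext h₁ h₂ h₃ h₄

/-- Fragments of the simulating machine. -/
abbrev SFrag (m : ℕ) (M : Fin n → TM2ComputableAux (Option A) A) :=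
  Frag (fun l : Loc m M => l.Alph) (Ctl M)

/-- The fragment `F` leads from one state and memory to another in at most `t` steps. -/
def Exec (F : SFrag m M) (s s' : Ctl M × Regs m M) (t : ℕ) : Prop :=
  F.Runs (s.1, s.2.stk) (s'.1, s'.2.stk) t

/-- Statements of the simulating machine that may jump back to their own beginning only. -/
abbrev SStmt (m : ℕ) (M : Fin n → TM2ComputableAux (Option A) A) :=
  TM2.Stmt (fun l : Loc m M => l.Alph) Unit (Ctl M)

/-- Pop a symbol from the stack `l`, put its translation into the buffer, and go on with `q`,
or stop if the stack is empty. -/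
def popThen (l : Loc m M) (rd : l.Alph → Option A) (q : SStmt m M) : SStmt m M :=
  .pop l (fun v a => { v with buf := a.map rd }) (.branch (fun v => v.buf.isSome) q .halt)

/-- Move the content of a stack symbol by symbol onto another stack. -/
def move (src dst : Loc m M) (rd : src.Alph → Option A) (wr : Option A → dst.Alph) : SFrag m M :=
  .single (popThen src rd (.push dst (fun v => wr (v.buf.getD none)) (.goto fun _ => ())))

theorem move_runs {src dst : Loc m M} (h : src ≠ dst) (rd : src.Alph → Option A)
    (wr : Option A → dst.Alph) (v : Ctl M) (T : ∀ l : Loc m M, List l.Alph) :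
    (move src dst rd wr).Runs (v, T) ({ v with buf := none },
      Function.update (Function.update T src []) dst
        ((T src).reverse.map (fun a => wr (rd a)) ++ T dst)) ((T src).length + 1) := by
  generalize hx : T src = x
  induction x generalizing v T with
  | nil =>
    refine Frag.single_halt ?_
    simp [popThen, hx, h.symm]
  | cons a x ih =>
    refine Frag.single_goto (v' := { v with buf := some (rd a) })
      (T' := Function.update (Function.update T src x) dst (wr (rd a) :: T dst)) ?_ ?_
    · simp [popThen, hx, h.symm]
    · have := ih { v with buf := some (rd a) }
        (Function.update (Function.update T src x) dst (wr (rd a) :: T dst)) (by simp [h])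
      rw [Function.update_comm h.symm] at this
      show (move src dst rd wr).Runs _ _ _
      simpa using this

/-- Empty a stack. -/
def clear (src : Loc m M) : SFrag m M :=
  .single (popThen src (fun _ => none) (.goto fun _ => ()))

theorem clear_runs (src : Loc m M) (v : Ctl M) (T : ∀ l : Loc m M, List l.Alph) :
    (clear src).Runs (v, T) ({ v with buf := none }, Function.update T src [])
      ((T src).length + 1) := by
  generalize hx : T src = x
  induction x generalizing v T with
  | nil =>
    refine Frag.single_halt ?_
    simp [popThen, hx]
  | cons a x ih =>
    refine Frag.single_goto (v' := { v with buf := some none })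
      (T' := Function.update T src x) ?_ ?_
    · simp [popThen, hx]
    · show (clear src).Runs _ _ _
      simpa using ih { v with buf := some none } (Function.update T src x) (by simp)

variable {v : Ctl M} {r : Regs m M}

theorem exec_move_tmp_work : Exec (move .tmp .work id id) (v, r) ({ v with buf := none },
    { r with tmp := [], work := r.tmp.reverse ++ r.work }) (r.tmp.length + 1) := by
  have := move_runs (m := m) (M := M) (src := .tmp) (dst := .work) (by simp) id id v r.stk
  rw [Regs.update_tmp, Regs.update_work] at this
  simpa [Exec, Regs.stk] using this

theorem exec_move_tmp_var (i : Fin m) : Exec (move .tmp (.var i) id id) (v, r)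
    ({ v with buf := none }, { r with
      tmp := [], vars := Function.update r.vars i (r.tmp.reverse ++ r.vars i) })
    (r.tmp.length + 1) := by
  have := move_runs (m := m) (M := M) (src := .tmp) (dst := .var i) (by simp) id id v r.stk
  rw [Regs.update_tmp, Regs.update_var] at this
  simpa [Exec, Regs.stk] using this

theorem exec_move_var_tmp (i : Fin m) : Exec (move (.var i) .tmp id id) (v, r)
    ({ v with buf := none }, { r with
      vars := Function.update r.vars i [], tmp := (r.vars i).reverse ++ r.tmp })
    ((r.vars i).length + 1) := by
  have := move_runs (m := m) (M := M) (src := .var i) (dst := .tmp) (by simp) id id v r.stk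
  rw [Regs.update_var, Regs.update_tmp] at this
  simpa [Exec, Regs.stk] using this

theorem exec_move_tmp_out (d : A) : Exec (move .tmp .out id fun a => a.getD d) (v, r)
    ({ v with buf := none }, { r with
      tmp := [], out := r.tmp.reverse.map (fun a => a.getD d) ++ r.out })
    (r.tmp.length + 1) := by
  have := move_runs (m := m) (M := M) (src := .tmp) (dst := .out) (by simp) id
    (fun a => a.getD d) v r.stk
  rw [Regs.update_tmp, Regs.update_out] at this
  simpa [Exec, Regs.stk] using this

theorem exec_move_tmp_op (i : Fin n) :
    Exec (move .tmp (.op i (M i).tm.k₀) id (M i).inputAlphabet.symm) (v, r)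
    ({ v with buf := none }, { r with
      tmp := [], ops := Function.update r.ops i (Function.update (r.ops i) (M i).tm.k₀
        (r.tmp.reverse.map (M i).inputAlphabet.symm ++ r.ops i (M i).tm.k₀)) })
    (r.tmp.length + 1) := by
  have := move_runs (m := m) (M := M) (src := .tmp) (dst := .op i (M i).tm.k₀) (by simp) id
    (M i).inputAlphabet.symm v r.stk
  rw [Regs.update_tmp, Regs.update_op] at this
  simpa [Exec, Regs.stk] using this

theorem exec_move_op_tmp (i : Fin n) :
    Exec (move (.op i (M i).tm.k₁) .tmp (fun a => some ((M i).outputAlphabet a)) id) (v, r)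
    ({ v with buf := none }, { r with
      ops := Function.update r.ops i (Function.update (r.ops i) (M i).tm.k₁ []),
      tmp := (r.ops i (M i).tm.k₁).reverse.map (fun a => some ((M i).outputAlphabet a)) ++ r.tmp })
    ((r.ops i (M i).tm.k₁).length + 1) := by
  have := move_runs (m := m) (M := M) (src := .op i (M i).tm.k₁) (dst := .tmp) (by simp)
    (fun a => some ((M i).outputAlphabet a)) id v r.stk
  rw [Regs.update_op, Regs.update_tmp] at this
  simpa [Exec, Regs.stk] using this

theorem exec_clear_tmp : Exec (clear .tmp) (v, r) ({ v with buf := none }, { r with tmp := [] })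
    (r.tmp.length + 1) := by
  have := clear_runs (m := m) (M := M) .tmp v r.stk
  rwa [Regs.update_tmp] at this

theorem exec_clear_var (i : Fin m) : Exec (clear (.var i)) (v, r)
    ({ v with buf := none }, { r with vars := Function.update r.vars i [] })
    ((r.vars i).length + 1) := by
  have := clear_runs (m := m) (M := M) (.var i) v r.stk
  rwa [Regs.update_var] at this

/-- Copy the auxiliary stack to a variable and to the work stack. -/
def dup (i : Fin m) : SFrag m M :=
  .single (popThen .tmp id (.push .work (fun v => v.buf.getD none)
    (.push (.var i) (fun v => v.buf.getD none) (.goto fun _ => ()))))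

theorem exec_dup (i : Fin m) : Exec (dup i) (v, r) ({ v with buf := none }, { r with
      tmp := [], work := r.tmp.reverse ++ r.work
      vars := Function.update r.vars i (r.tmp.reverse ++ r.vars i) }) (r.tmp.length + 1) := by
  generalize hx : r.tmp = x
  induction x generalizing v r with
  | nil =>
    refine Frag.single_halt ?_
    simp [popThen, Regs.update_tmp, Regs.stk, hx]
  | cons a x ih =>
    refine Frag.single_goto (v' := { v with buf := some a })
      (T' := { r with
        tmp := x, work := a :: r.work, vars := Function.update r.vars i (a :: r.vars i) }.stk) ?_ ?_
    · simp [popThen, Regs.stk, hx, Regs.update_tmp, Regs.update_work, Regs.update_var]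
    · have := ih (v := { v with buf := some a }) (r := { r with
        tmp := x, work := a :: r.work, vars := Function.update r.vars i (a :: r.vars i) }) rfl
      show (dup i).Runs _ _ _
      simpa [Exec] using this

/-- A word followed by the end marker `none`. -/
def enc (w : Word A) : List (Option A) := w.map some ++ [none]

theorem enc_nil : enc ([] : Word A) = [none] := rfl

theorem enc_cons (a : A) (w : Word A) : enc (a :: w) = some a :: enc w := rfl

theorem encodeTuple_eq {k : ℕ} (w : Fin k → Word A) :
    encodeTuple w = (List.ofFn w).flatMap enc := rfl

/-- Move the uppermost word of the work stack, with its end marker, to the auxiliary stack. -/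
def take : SFrag m M :=
  .single (popThen .work id (.push .tmp (fun v => v.buf.getD none)
    (.branch (fun v => v.buf.join.isSome) (.goto fun _ => ()) .halt)))

theorem exec_take (w : Word A) (W : List (Option A)) (h : r.work = enc w ++ W) :
    Exec take (v, r) ({ v with buf := some none },
      { r with work := W, tmp := (enc w).reverse ++ r.tmp }) (w.length + 1) := by
  induction w generalizing v r with
  | nil =>
    refine Frag.single_halt ?_
    rw [enc_nil] at h
    simp [popThen, Regs.update_work, Regs.update_tmp, Regs.stk, h, enc]
  | cons a w ih =>
    rw [enc_cons] at h
    refine Frag.single_goto (v' := { v with buf := some (some a) })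
      (T' := { r with work := enc w ++ W, tmp := some a :: r.tmp }.stk) ?_ ?_
    · simp [popThen, Regs.stk, h, Regs.update_tmp, Regs.update_work]
    · have := ih (v := { v with buf := some (some a) })
        (r := { r with work := enc w ++ W, tmp := some a :: r.tmp }) rfl
      show take.Runs _ _ _
      simpa [Exec, enc_cons] using this

/-- Do nothing except for changing the internal state. -/
def setCtl (f : Ctl M → Ctl M) : SFrag m M := .single (.load f .halt)

theorem exec_setCtl (f : Ctl M → Ctl M) : Exec (setCtl f) (v, r) (f v, r) 1 :=
  Frag.single_halt rfl

/-- Push an end marker on the work stack. -/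
def pushEnd : SFrag m M := .single (.push .work (fun _ => none) .halt)

theorem exec_pushEnd : Exec pushEnd (v, r) (v, { r with work := none :: r.work }) 1 :=
  Frag.single_halt (by simp [Regs.stk, Regs.update_work])

/-- Remove a symbol from the auxiliary stack. -/
def dropTmp : SFrag m M := .single (.pop .tmp (fun v _ => v) .halt)

theorem exec_dropTmp : Exec dropTmp (v, r) (v, { r with tmp := r.tmp.tail }) 1 :=
  Frag.single_halt (by simp [Regs.stk, Regs.update_tmp])

end Memory

/-! ### Running the machine of an operator -/

section OperatorCall

open Turing

variable {A : Type} {m n : ℕ} {M : Fin n → TM2ComputableAux (Option A) A}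

theorem reach_iff_iterate {K Λ σ : Type} [DecidableEq K] {Γ : K → Type}
    {P : Λ → TM2.Stmt Γ Λ σ} {k : ℕ} {c c' : TM2.Cfg Γ Λ σ} :
    Reach P k c c' ↔ (flip bind (TM2.step P))^[k] (some c) = some c' := by
  induction k generalizing c with
  | zero =>
    refine ⟨fun h => ?_, fun h => ?_⟩
    · cases h; rfl
    · cases h; exact .refl _
  | succ k ih =>
    obtain ⟨l, v, T⟩ := c
    rw [Function.iterate_succ_apply]
    cases l with
    | none =>
      have h (k : ℕ) : (flip bind (TM2.step P))^[k] none = none := by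
        induction k with
        | zero => rfl
        | succ k ih => rw [Function.iterate_succ_apply]; exact ih
      refine ⟨fun h => (by cases h), fun h' => ?_⟩
      exact absurd ((h k).symm.trans h') (by simp)
    | some l =>
      refine ⟨fun h => ?_, fun h => .head (ih.2 h)⟩
      cases h with
      | head h => exact ih.1 h

theorem initList_eq (tm : FinTM2) (s : List (tm.Γ tm.k₀)) :
    initList tm s = ⟨some tm.main, tm.initialState, Function.update (fun _ => []) tm.k₀ s⟩ := by
  unfold initList
  congr 1
  funext k
  by_cases h : k = tm.k₀
  · subst h; simp
  · simp [h]

theorem haltList_eq (tm : FinTM2) (s : List (tm.Γ tm.k₁)) :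
    haltList tm s = ⟨none, tm.initialState, Function.update (fun _ => []) tm.k₁ s⟩ := by
  unfold haltList
  congr 1
  funext k
  by_cases h : k = tm.k₁
  · subst h; simp
  · simp [h]

/-- The machine of the operator `i` as a fragment. -/
def runOp (i : Fin n) : SFrag m M where
  Λ := (M i).tm.Λ
  fin := (M i).tm.ΛFin
  entry := (M i).tm.main
  m l := liftStmt (fun k => Loc.op i k) (fun v => v.sub i)
    (fun a v => { v with sub := Function.update v.sub i a }) ((M i).tm.m l)

/-- A computation of the machine of an operator, carried out on the stacks and the internal state
reserved for it. The machine is back in its initial state afterwards, ready for the next call. -/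
theorem exec_runOp {i : Fin n} {v : Ctl M} {r : Regs m M} {s : List ((M i).tm.Γ (M i).tm.k₀)}
    {s' : List ((M i).tm.Γ (M i).tm.k₁)} {t : ℕ} (h : TM2OutputsInTime (M i).tm s (some s') t)
    (hv : v.sub i = (M i).tm.initialState)
    (hr : r.ops i = Function.update (fun _ => []) (M i).tm.k₀ s) :
    Exec (runOp i) (v, r) (v, { r with
      ops := Function.update r.ops i (Function.update (fun _ => []) (M i).tm.k₁ s') }) t := by
  obtain ⟨⟨k, hk⟩, hle⟩ := h
  refine ⟨k, hle, ?_⟩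
  have h := reach_iff_iterate.2 hk
  rw [initList_eq, haltList_eq] at h
  have := h.liftStmt (Γ := fun l : Loc m M => l.Alph) (ι := fun k => Loc.op i k)
    (get := fun v : Ctl M => v.sub i)
    (set := fun a v => { v with sub := Function.update v.sub i a })
    (var := fun a => { v with sub := Function.update v.sub i a })
    (stk := fun T => { r with ops := Function.update r.ops i T }.stk)
    (by simp) (by simp) (by simp [Regs.stk]) (fun T k x => by
      rw [Regs.update_op]; simp)
  simp only [← hv, ← hr, Function.update_eq_self] at this
  exact this

end OperatorCall

/-! ### Evaluating expressions by a machine -/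

section Expressions

open Turing

variable {A : Type} {m n : ℕ} {M : Fin n → TM2ComputableAux (Option A) A}

/-- The machines of the operators are in their initial states. -/
def Ctl.Idle (v : Ctl M) : Prop := ∀ i, v.sub i = (M i).tm.initialState

/-- The fragment `F` transforms the memory `r` into `r'` in at most `t` steps, without breaking the
flow. -/
def Does (F : SFrag m M) (r r' : Regs m M) (t : ℕ) : Prop :=
  ∀ v : Ctl M, v.Idle → ∃ v' : Ctl M, v'.Idle ∧ v'.broken = v.broken ∧ Exec F (v, r) (v', r') t

theorem Does.of_exec {F : SFrag m M} {r r' : Regs m M} {t : ℕ} {b : Option (Option A)}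
    (h : ∀ v, Exec F (v, r) ({ v with buf := b }, r') t) : Does F r r' t :=
  fun v hv => ⟨{ v with buf := b }, hv, rfl, h v⟩

theorem Does.of_exec' {F : SFrag m M} {r r' : Regs m M} {t : ℕ}
    (h : ∀ v : Ctl M, v.Idle → Exec F (v, r) (v, r') t) : Does F r r' t :=
  fun v hv => ⟨_, hv, rfl, h v hv⟩

theorem Does.seq {F G : SFrag m M} {r₁ r₂ r₃ : Regs m M} {t₁ t₂ : ℕ} (h₁ : Does F r₁ r₂ t₁)
    (h₂ : Does G r₂ r₃ t₂) : Does (F.seq G) r₁ r₃ (t₁ + t₂) := by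
  intro v hv
  obtain ⟨v₁, hv₁, hb₁, h₁⟩ := h₁ v hv
  obtain ⟨v₂, hv₂, hb₂, h₂⟩ := h₂ v₁ hv₁
  exact ⟨v₂, hv₂, hb₂.trans hb₁, Frag.Runs.seq h₁ h₂⟩

theorem Does.cast {F : SFrag m M} {r r' r'' : Regs m M} {t t' : ℕ} (h : Does F r r' t)
    (hr : r' = r'') (ht : t ≤ t') : Does F r r'' t' := by
  subst hr
  intro v hv
  obtain ⟨v', hv', hb, h⟩ := h v hv
  exact ⟨v', hv', hb, Frag.Runs.mono h ht⟩

/-- Move the `k` uppermost words of the work stack, with their end markers, to the auxiliary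
stack. -/
def takeAll : ℕ → SFrag m M
  | 0 => setCtl id
  | k + 1 => take.seq (takeAll k)

theorem does_takeAll (ws : List (Word A)) {W : List (Option A)} {r : Regs m M}
    (h : r.work = ws.flatMap enc ++ W) :
    Does (takeAll ws.length) r { r with work := W, tmp := (ws.flatMap enc).reverse ++ r.tmp }
      ((ws.flatMap enc).length + 1) := by
  induction ws generalizing r with
  | nil =>
    refine .of_exec' fun v hv => ?_
    have : { r with work := W, tmp := ([].flatMap enc).reverse ++ r.tmp } = r := by
      ext1 <;> simp_all
    rw [this]
    exact exec_setCtl id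
  | cons w ws ih =>
    rw [List.flatMap_cons, List.append_assoc] at h
    have h₁ : Does take r _ _ := .of_exec fun v => exec_take (v := v) w _ h
    exact (h₁.seq (ih rfl)).cast (by simp) (by simp [enc]; omega)

/-- Compute the minimum of two lengths in unary: as long as there are symbols of the uppermost word
of the work stack and on the auxiliary stack, pop one of each and push the letter `1`. -/
def minUnary [BitAlphabet A] : SFrag m M :=
  .single (popThen .work id (.branch (fun v => v.buf.join.isSome)
    (.pop .tmp (fun v a => { v with test := a.isSome })
      (.branch (fun v => v.test)
        (.push .cnt (fun _ => some BitAlphabet.one) (.goto fun _ => ()))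
        (.goto fun _ => ())))
    .halt))

theorem does_minUnary [BitAlphabet A] (w : Word A) {W : List (Option A)} {r : Regs m M}
    (h : r.work = enc w ++ W) :
    Does minUnary r { r with
      work := W, tmp := r.tmp.drop w.length
      cnt := (unary (min r.tmp.length w.length)).map some ++ r.cnt } (w.length + 1) := by
  have key (v : Ctl M) : ∃ b, Exec minUnary (v, r) ({ v with buf := some none, test := b }, { r with
      work := W, tmp := r.tmp.drop w.length
      cnt := (unary (min r.tmp.length w.length)).map some ++ r.cnt }) (w.length + 1) := by
    induction w generalizing v r with
    | nil =>
      refine ⟨v.test, Frag.single_halt ?_⟩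
      rw [enc_nil] at h
      simp [popThen, Regs.update_work, Regs.stk, h, unary]
    | cons a w ih =>
      rw [enc_cons] at h
      cases hx : r.tmp with
      | nil =>
        obtain ⟨b, ih⟩ := ih (v := { v with buf := some (some a), test := false })
          (r := { r with work := enc w ++ W }) rfl
        refine ⟨b, Frag.single_goto (v' := { v with buf := some (some a), test := false })
          (T' := { r with work := enc w ++ W }.stk) ?_ ?_⟩
        · simp [popThen, Regs.stk, h, hx, Regs.update_tmp, Regs.update_work]
        · show minUnary.Runs _ _ _
          simpa [Exec, hx] using ih
      | cons c x =>
        obtain ⟨b, ih⟩ := ih (v := { v with buf := some (some a), test := true })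
          (r := { r with
            work := enc w ++ W, tmp := x, cnt := some BitAlphabet.one :: r.cnt }) rfl
        refine ⟨b, Frag.single_goto (v' := { v with buf := some (some a), test := true })
          (T' := { r with
            work := enc w ++ W, tmp := x, cnt := some BitAlphabet.one :: r.cnt }.stk) ?_ ?_⟩
        · simp [popThen, Regs.stk, h, hx, Regs.update_tmp, Regs.update_work, Regs.update_cnt]
        · show minUnary.Runs _ _ _
          have hu (k : ℕ) (y : List (Option A)) :
              (unary k).map some ++ some BitAlphabet.one :: y =
                (unary (k + 1)).map some ++ y := by
            simp [unary, List.replicate_succ']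
          simpa [Exec, hu, Nat.add_min_add_right] using ih
  intro v hv
  obtain ⟨b, hb⟩ := key v
  exact ⟨{ v with buf := some none, test := b }, hv, rfl, hb⟩

theorem does_move_cnt_work {r : Regs m M} : Does (move .cnt .work id id) r
    { r with cnt := [], work := r.cnt.reverse ++ r.work } (r.cnt.length + 1) := by
  refine .of_exec (b := none) fun v => ?_
  have := move_runs (m := m) (M := M) (src := .cnt) (dst := .work) (by simp) id id v r.stk
  rw [Regs.update_cnt, Regs.update_work] at this
  simpa [Exec, Regs.stk] using this

/-- Pop the uppermost word of the work stack and test whether it is the truth value `1`. -/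
noncomputable def testWord [BitAlphabet A] : SFrag m M :=
  let _ : DecidableEq A := Classical.decEq A
  take.seq (dropTmp.seq ((Frag.single
    (.pop .tmp (fun v a => { v with test := decide (a = some (some BitAlphabet.one)) })
      (.pop .tmp (fun v a => { v with test := v.test && a.isNone }) .halt))).seq (clear .tmp)))

theorem exec_testWord [BitAlphabet A] (w : Word A) {W : List (Option A)} {v : Ctl M}
    {r : Regs m M} (h : r.work = enc w ++ W) (hr : r.tmp = []) :
    Exec testWord (v, r)
      ({ v with buf := none, test := open Classical in decide (w = wordOne) }, { r with work := W })
      (2 * w.length + 4) := by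
  classical
  have h₁ := exec_take (v := v) w W h
  have h₂ := exec_dropTmp (v := { v with buf := some none })
    (r := { r with work := W, tmp := (enc w).reverse ++ r.tmp })
  have h₃ : Exec (Frag.single
      (.pop .tmp (fun v a => { v with test := decide (a = some (some BitAlphabet.one)) })
      (.pop .tmp (fun v a => { v with test := v.test && a.isNone }) .halt)))
      ({ v with buf := some none }, { r with work := W, tmp := ((enc w).reverse ++ r.tmp).tail })
      ({ v with buf := some none, test := decide (w = wordOne) },
        { r with work := W, tmp := ((enc w).reverse ++ r.tmp).tail.tail.tail }) 1 := by
    refine Frag.single_halt ?_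
    -- a word is `1` iff its last letter is `1` and nothing precedes it
    have htest : (decide (((w.map some).reverse).head? = some (some (BitAlphabet.one : A))) &&
        ((w.map some).reverse).tail.head?.isNone) = decide (w = wordOne) := by
      rw [Bool.eq_iff_iff]
      rcases List.eq_nil_or_concat w with rfl | ⟨w', a, rfl⟩
      · simp [wordOne]
      · rcases List.eq_nil_or_concat w' with rfl | ⟨w'', b, rfl⟩
        · simp [wordOne]
        · have : w'' ++ [b, a] ≠ [BitAlphabet.one] := fun h => by
            simpa using congrArg List.length h
          simp [wordOne, this]
    simpa [Regs.stk, Regs.update_tmp, hr, enc] using htest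
  have h₄ := exec_clear_tmp (v := { v with buf := some none, test := decide (w = wordOne) })
    (r := { r with work := W, tmp := ((enc w).reverse ++ r.tmp).tail.tail.tail })
  have := Frag.Runs.seq h₁ (Frag.Runs.seq h₂ (Frag.Runs.seq h₃ h₄))
  have hlast : { r with work := W, tmp := [] } = { r with work := W } := by
    ext1 <;> simp [hr]
  rw [← hlast]
  exact (show testWord.Runs _ _ _ from this).mono (by simp [hr, enc]; omega)

end Expressions

section Compilation

open Turing

variable {A : Type} {m n : ℕ} {M : Fin n → TM2ComputableAux (Option A) A}

/-- Replace the uppermost words of the work stack, which are the arguments of the operator `i` of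
arity `k`, by the value of the operator. -/
def callOp (i : Fin n) (k : ℕ) : SFrag m M :=
  (takeAll k).seq <| (move .tmp (.op i (M i).tm.k₀) id (M i).inputAlphabet.symm).seq <|
    (runOp i).seq <|
    (move (.op i (M i).tm.k₁) .tmp (fun a => some ((M i).outputAlphabet a)) id).seq <|
    pushEnd.seq (move .tmp .work id id)

theorem does_callOp {i : Fin n} {k : ℕ} {w : Fin k → Word A} {u : Word A} {t : ℕ}
    (h : TM2OutputsInTime (M i).tm ((encodeTuple w).map (M i).inputAlphabet.symm)
      (some (u.map (M i).outputAlphabet.symm)) t)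
    {W : List (Option A)} {r : Regs m M} (hw : r.work = encodeTuple w ++ W) (ht : r.tmp = [])
    (ho : r.ops = fun _ _ => []) :
    Does (callOp i k) r { r with work := enc u ++ W }
      (2 * (encodeTuple w).length + t + 2 * u.length + 6) := by
  rw [encodeTuple_eq] at hw
  have h₁ := does_takeAll _ hw
  rw [List.length_ofFn] at h₁
  have h₂ := h₁.seq <| .seq (.of_exec fun v => exec_move_tmp_op i) <|
    .seq (.of_exec' fun v hv => exec_runOp h (hv i) (by simp [ht, ho, ← encodeTuple_eq])) <|
    .seq (.of_exec fun v => exec_move_op_tmp i) <|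
    .seq (.of_exec' fun v _ => exec_pushEnd) (.of_exec fun v => exec_move_tmp_work)
  refine h₂.cast ?_ ?_
  · ext1
    · rfl
    · simp [enc, Function.comp_def]
    · simp [ht]
    · rfl
    · rfl
    · simp only [ho]
      funext j
      by_cases hj : j = i
      · subst hj; simp
      · simp [hj]
  · simp [ht, encodeTuple_eq]
    omega

variable [BitAlphabet A] {S : Operators.{u} A} {V : Type v}

/-- The memory holding a store and a content of the work stack. -/
def regsOf (x : Fin m → V) (μ : Store A V) (W : List (Option A)) : Regs m M where
  vars i := (μ (x i)).map some
  work := W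
  tmp := []
  cnt := []
  out := []
  ops _ _ := []

/-- The fragment `F` pushes `g μ` on the work stack, where `μ` is the current store, in polynomial
time. -/
def Pushes (Γ : VarEnv V) (x : Fin m → V) (F : SFrag m M) (g : Store A V → List (Option A))
    (p : Polynomial ℕ) : Prop :=
  ∀ N μ W, BoundedFrom Γ 0 N μ → Does F (regsOf x μ W) (regsOf x μ (g μ ++ W)) (p.eval N)

omit [BitAlphabet A] in
theorem exists_pushes_flatMap {Γ : VarEnv V} {x : Fin m → V}
    (gs : List (Store A V → List (Option A)))
    (h : ∀ g ∈ gs, ∃ (F : SFrag m M) (p : Polynomial ℕ), Pushes Γ x F g p) :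
    ∃ (F : SFrag m M) (p : Polynomial ℕ), Pushes Γ x F (fun μ => gs.flatMap fun g => g μ) p := by
  induction gs with
  | nil =>
    refine ⟨setCtl id, 1, fun N μ W _ => .of_exec' fun v _ => ?_⟩
    rw [Polynomial.eval_one]
    exact exec_setCtl id
  | cons g gs ih =>
    rw [List.forall_mem_cons] at h
    obtain ⟨⟨F, p, hF⟩, h⟩ := h
    obtain ⟨G, q, hG⟩ := ih h
    refine ⟨G.seq F, q + p, fun N μ W hμ => ?_⟩
    have := (hG N μ W hμ).seq (hF N μ _ hμ)
    simpa using this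

/-- Every typable expression can be evaluated in polynomial time, its value being pushed on the work
stack. -/
theorem ExprTyped.exists_pushes {Γ : VarEnv V} {Δ : OpEnv S} (hΔ : Δ.Safe) {x : Fin m → V}
    (hx : ∀ y τ, Γ y = some τ → ∃ i, x i = y) {f : Fin n → S.Op} (hf : ∀ o ∈ Δ.dom, ∃ i, f i = o)
    (comp : ∀ i, TM2ComputableInPolyTime (αΓ := Option A) (βΓ := A) encodeTuple (fun v => v)
      (S.sem (f i)))
    {i o τ : ℕ} {e : Expr S V} (h : ExprTyped Γ Δ i o e τ) :
    ∃ (F : SFrag m fun i => (comp i).toTM2ComputableAux) (p : Polynomial ℕ),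
      Pushes Γ x F (fun μ => enc (e.eval μ)) p := by
  induction h with
  | @var y τ hy =>
    obtain ⟨j, rfl⟩ := hx y τ hy
    refine ⟨pushEnd.seq ((move (.var j) .tmp id id).seq (dup j)), 2 * .X + 3, fun N μ W hμ => ?_⟩
    have h := Does.seq (.of_exec' fun v _ => exec_pushEnd (v := v)
        (r := regsOf (M := fun i => (comp i).toTM2ComputableAux) x μ W)) <|
      .seq (.of_exec fun v => exec_move_var_tmp j) (.of_exec fun v => exec_dup j)
    have hle := hμ _ _ hy (Nat.zero_le _)
    refine h.cast ?_ ?_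
    · ext1 <;> simp [regsOf, enc, Expr.eval]
    · simp [regsOf]
      omega
  | @op g args τ τ' hg _ ha ih =>
    obtain ⟨j, rfl⟩ := hf g hg
    obtain ⟨F, p, hF⟩ := exists_pushes_flatMap
      (List.ofFn fun k => fun μ : Store A V => enc ((args k).eval μ)) (by
        intro g hg
        obtain ⟨k, rfl⟩ := (List.mem_ofFn' _ _).1 hg
        exact ih k)
    choose q hq using fun k => (ha k).exists_polynomial hΔ
    obtain ⟨pf, hpf⟩ := hΔ.isPolynomial hg
    refine ⟨F.seq (callOp j (S.ar (f j))), p + (2 * (∑ k, (q k + 1)) +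
      (comp j).time.comp (∑ k, (q k + 1)) + 2 * pf.comp (∑ k, q k) + 6), fun N μ W hμ => ?_⟩
    have h₁ := hF N μ W hμ
    have henc : ((List.ofFn fun k => fun μ : Store A V => enc ((args k).eval μ)).flatMap
        fun g => g μ) = encodeTuple fun k => (args k).eval μ := by
      rw [encodeTuple_eq, List.flatMap, List.flatMap, List.map_ofFn, List.map_ofFn]
      rfl
    beta_reduce at h₁
    rw [henc] at h₁
    have h₂ := h₁.seq (does_callOp ((comp j).outputsFun fun k => (args k).eval μ) rfl rfl rfl)
    refine h₂.cast rfl ?_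
    have hlen : (encodeTuple fun k => (args k).eval μ).length ≤
        (∑ k, (q k + 1) : Polynomial ℕ).eval N := by
      rw [encodeTuple_eq, List.length_flatMap, List.map_ofFn, List.sum_ofFn,
        Polynomial.eval_finsetSum]
      refine Finset.sum_le_sum fun k _ => ?_
      simpa [enc] using hq k N μ hμ
    have hval : (S.sem (f j) fun k => (args k).eval μ).length ≤
        pf.eval ((∑ k, q k : Polynomial ℕ).eval N) := by
      refine (hpf _).trans (polynomial_eval_mono pf (maxLength_le fun k => (hq k N μ hμ).trans ?_))
      rw [Polynomial.eval_finsetSum]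
      exact Finset.single_le_sum (f := fun k => (q k).eval N) (fun _ _ => Nat.zero_le _)
        (Finset.mem_univ k)
    have htime := polynomial_eval_mono (comp j).time hlen
    simp only [Polynomial.eval_add, Polynomial.eval_mul, Polynomial.eval_comp,
      Polynomial.eval_ofNat]
    omega
  | @declass e₁ e₂ _ _ h₁ h₂ _ _ ih₁ ih₂ =>
    obtain ⟨F₁, p₁, hF₁⟩ := ih₁
    obtain ⟨F₂, p₂, hF₂⟩ := ih₂
    obtain ⟨q₁, hq₁⟩ := h₁.exists_polynomial hΔ
    obtain ⟨q₂, hq₂⟩ := h₂.exists_polynomial hΔ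
    refine ⟨F₂.seq (F₁.seq (take.seq (dropTmp.seq (minUnary.seq ((clear .tmp).seq
      (pushEnd.seq (move .cnt .work id id))))))), p₂ + p₁ + 3 * q₁ + q₂ + 8, fun N μ W hμ => ?_⟩
    have h := (hF₂ N μ W hμ).seq <| (hF₁ N μ _ hμ).seq <|
      Does.seq (.of_exec fun v => exec_take (v := v) (e₁.eval μ) _ rfl) <|
      Does.seq (.of_exec' fun v _ => exec_dropTmp) <|
      Does.seq (does_minUnary (e₂.eval μ) rfl) <|
      Does.seq (.of_exec fun v => exec_clear_tmp) <|
      Does.seq (.of_exec' fun v _ => exec_pushEnd) does_move_cnt_work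
    have hle₁ := hq₁ N μ hμ
    have hle₂ := hq₂ N μ hμ
    refine h.cast ?_ ?_
    · ext1 <;> simp [regsOf, enc, Expr.eval, unary]
    · simp [regsOf, enc, unary]
      omega

end Compilation

/-! ### Running statements by a machine -/

section Statements

open Turing

variable {A : Type} {m n : ℕ} {M : Fin n → TM2ComputableAux (Option A) A}
variable {S : Operators.{u} A} {V : Type v} [DecidableEq V]

/-- Store the uppermost word of the work stack in a variable. -/
def storeWord (j : Fin m) : SFrag m M :=
  take.seq (dropTmp.seq ((clear (.var j)).seq (move .tmp (.var j) id id)))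

theorem does_storeWord {x : Fin m → V} (hx : x.Injective) (j : Fin m) (μ : Store A V) (w : Word A)
    (W : List (Option A)) : Does (M := M) (storeWord j) (regsOf x μ (enc w ++ W))
      (regsOf x (Function.update μ (x j) w) W) (2 * w.length + (μ (x j)).length + 4) := by
  have h := Does.seq (M := M)
      (.of_exec fun v => exec_take (v := v) (r := regsOf x μ (enc w ++ W)) w _ rfl) <|
    Does.seq (.of_exec' fun v _ => exec_dropTmp) <|
    Does.seq (.of_exec fun v => exec_clear_var j) (.of_exec fun v => exec_move_tmp_var j)
  refine h.cast ?_ ?_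
  · ext1
    · funext k
      by_cases hk : k = j
      · subst hk; simp [regsOf, enc]
      · simp [regsOf, hk, hx.ne hk]
    all_goals rfl
  · simp [regsOf, enc]
    omega

namespace Exec

variable {F G : SFrag m M} {p : Ctl M → Bool} {v : Ctl M} {r : Regs m M} {s s' : Ctl M × Regs m M}
  {t t' : ℕ}

theorem mono (h : Exec F s s' t) (ht : t ≤ t') : Exec F s s' t' := Frag.Runs.mono h ht

theorem seq (h₁ : Exec F (v, r) s t) (h₂ : Exec G s s' t') :
    Exec (F.seq G) (v, r) s' (t + t') := Frag.Runs.seq h₁ h₂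

theorem ite_true (G : SFrag m M) (hp : p v = true) (h : Exec F (v, r) s t) :
    Exec (.ite p F G) (v, r) s (t + 1) := Frag.Runs.ite_true G hp h

theorem ite_false (F : SFrag m M) (hp : p v = false) (h : Exec G (v, r) s t) :
    Exec (.ite p F G) (v, r) s (t + 1) := Frag.Runs.ite_false F hp h

theorem loop_false (F : SFrag m M) (hp : p v = false) : Exec (.loop p F) (v, r) (v, r) 1 :=
  Frag.Runs.loop_false F hp

theorem loop_true (hp : p v = true) (h : Exec F (v, r) s t) (h' : Exec (.loop p F) s s' t') :
    Exec (.loop p F) (v, r) s' (t + t' + 1) := Frag.Runs.loop_true hp h h'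

end Exec

variable [BitAlphabet A]

/-- The fragment `F` sets the test bit to the truth value of `e` in the current store. -/
def Tests (Γ : VarEnv V) (x : Fin m → V) (F : SFrag m M) (e : Expr S V) (p : Polynomial ℕ) :
    Prop :=
  ∀ N μ (v : Ctl M), BoundedFrom Γ 0 N μ → v.Idle → ∃ v' : Ctl M, v'.Idle ∧
    v'.broken = v.broken ∧ (v'.test = true ↔ e.eval μ = wordOne) ∧
    Exec F (v, regsOf x μ []) (v', regsOf x μ []) (p.eval N)

omit [DecidableEq V] in
theorem Pushes.tests {Γ : VarEnv V} {x : Fin m → V} {F : SFrag m M} {e : Expr S V}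
    {p q : Polynomial ℕ} (hF : Pushes Γ x F (fun μ => enc (e.eval μ)) p)
    (hq : ∀ N μ, BoundedFrom Γ 0 N μ → (e.eval μ).length ≤ q.eval N) :
    Tests Γ x (F.seq testWord) e (p + 2 * q + 4) := by
  intro N μ v hμ hv
  obtain ⟨v₁, hv₁, hb₁, h₁⟩ := hF N μ [] hμ v hv
  have h₂ := exec_testWord (v := v₁) (e.eval μ) (r := regsOf x μ (enc (e.eval μ) ++ [])) rfl rfl
  refine ⟨_, fun i => ?_, ?_, ?_, (h₁.seq h₂).mono ?_⟩
  · exact hv₁ i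
  · exact hb₁
  · simp
  have := hq N μ hμ
  simp
  omega

/-- The flag as a bit. -/
def Flag.isBroken : Flag → Bool
  | .cont => false
  | .broken => true

/-- The fragment `F` simulates the traces of `a`, in time polynomial in the size of the stores for
each step. -/
def Simulates (Γ : VarEnv V) (x : Fin m → V) (F : SFrag m M) (a : LStmt S V) (p : Polynomial ℕ) :
    Prop :=
  ∀ i μ b μ' t N (v : Ctl M), Trace i μ a b μ' t → BoundedFrom Γ 0 N μ' →
    (∀ r ∈ t, BoundedFrom Γ 0 N r.2) → v.Idle → v.broken = false →
    ∃ v' : Ctl M, v'.Idle ∧ v'.broken = b.isBroken ∧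
      Exec F (v, regsOf x μ []) (v', regsOf x μ' []) (t.length * p.eval N)

/-- The initial store of a trace is recorded in it. -/
theorem Trace.head_mem {i : ℕ} {μ μ' : Store A V} {a : LStmt S V} {b : Flag}
    {t : List (ℕ × Store A V)} (h : Trace i μ a b μ' t) : ∃ l, (l, μ) ∈ t := by
  induction h with
  | seq _ _ ih _ => exact ih.imp fun l hl => List.mem_append_left _ hl
  | seq_broken _ ih => exact ih
  | _ => exact ⟨_, List.mem_cons_self⟩

theorem simulates_skip {Γ : VarEnv V} {x : Fin m → V} :
    Simulates (S := S) Γ x (setCtl id : SFrag m M) .skip 1 := by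
  intro i μ b μ' t N v h _ _ hv hb
  cases h
  exact ⟨v, hv, hb, by simpa using exec_setCtl id⟩

theorem simulates_assign {Γ : VarEnv V} {x : Fin m → V} (hx : x.Injective) {F : SFrag m M}
    {e : Expr S V} {p : Polynomial ℕ} (hF : Pushes Γ x F (fun μ => enc (e.eval μ)) p) {j : Fin m}
    {τ : ℕ} (hj : Γ (x j) = some τ) :
    Simulates Γ x (F.seq (storeWord j)) (.assign (x j) e) (p + 3 * .X + 4) := by
  intro i μ b μ' t N v h hμ' ht hv hb
  cases h
  have hμ : BoundedFrom Γ 0 N μ := by simpa using ht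
  obtain ⟨v', hv', hb', h⟩ := ((hF N μ [] hμ).seq (does_storeWord hx j μ _ _)).cast rfl
    (t' := 1 * (p + 3 * .X + 4 : Polynomial ℕ).eval N) (by
      have h₁ := hμ _ _ hj (Nat.zero_le _)
      have h₂ := hμ' _ _ hj (Nat.zero_le _)
      rw [Function.update_self] at h₂
      simp
      omega) v hv
  exact ⟨v', hv', hb'.trans hb, h⟩

/-- The second statement is skipped if the first one sets the bit for breaking the flow. -/
theorem Simulates.seq {Γ : VarEnv V} {x : Fin m → V} {F G : SFrag m M} {a₁ a₂ : LStmt S V}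
    {p q : Polynomial ℕ} (hF : Simulates Γ x F a₁ p) (hG : Simulates Γ x G a₂ q) :
    Simulates Γ x (F.seq (.ite Ctl.broken (setCtl id) G)) (.seq a₁ a₂) (p + q + 2) := by
  intro i μ b μ' t N v h hμ' ht hv hb
  cases h with
  | @seq _ _ μ₁ _ _ _ _ t₁ t₂ h₁ h₂ =>
    rw [List.forall_mem_append] at ht
    obtain ⟨l, hl⟩ := h₂.head_mem
    obtain ⟨v₁, hv₁, hb₁, h₁'⟩ := hF i μ _ μ₁ t₁ N v h₁ (ht.2 _ hl) ht.1 hv hb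
    obtain ⟨v₂, hv₂, hb₂, h₂'⟩ := hG i μ₁ b μ' t₂ N v₁ h₂ hμ' ht.2 hv₁ hb₁
    refine ⟨v₂, hv₂, hb₂, (h₁'.seq (.ite_false _ hb₁ h₂')).mono ?_⟩
    have := h₂.length_pos
    simp only [List.length_append, Polynomial.eval_add, Polynomial.eval_ofNat]
    nlinarith
  | seq_broken h₁ =>
    obtain ⟨v₁, hv₁, hb₁, h₁'⟩ := hF i μ _ μ' t N v h₁ hμ' ht hv hb
    refine ⟨v₁, hv₁, hb₁,
      (h₁'.seq (.ite_true _ hb₁ (exec_setCtl id))).mono ?_⟩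
    have := h₁.length_pos
    simp only [Polynomial.eval_add, Polynomial.eval_ofNat]
    nlinarith

theorem Simulates.ite {Γ : VarEnv V} {x : Fin m → V} {E F G : SFrag m M} {e : Expr S V}
    {a₁ a₀ : LStmt S V} {pe p q : Polynomial ℕ} (hE : Tests Γ x E e pe)
    (hF : Simulates Γ x F a₁ p) (hG : Simulates Γ x G a₀ q) :
    Simulates Γ x (E.seq (.ite Ctl.test F G)) (.ite e a₁ a₀) (pe + p + q + 1) := by
  intro i μ b μ' t N v h hμ' ht hv hb
  cases h with
  | ite_true he h =>
    rw [List.forall_mem_cons] at ht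
    obtain ⟨v₁, hv₁, hb₁, ht₁, h₁⟩ := hE N μ v ht.1 hv
    obtain ⟨v₂, hv₂, hb₂, h₂⟩ := hF _ _ _ _ _ N v₁ h hμ' ht.2 hv₁ (hb₁.trans hb)
    refine ⟨v₂, hv₂, hb₂, (h₁.seq
      (.ite_true _ (ht₁.2 he) h₂)).mono ?_⟩
    simp only [List.length_cons, Polynomial.eval_add, Polynomial.eval_one]
    nlinarith
  | ite_false he h =>
    rw [List.forall_mem_cons] at ht
    obtain ⟨v₁, hv₁, hb₁, ht₁, h₁⟩ := hE N μ v ht.1 hv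
    obtain ⟨v₂, hv₂, hb₂, h₂⟩ := hG _ _ _ _ _ N v₁ h hμ' ht.2 hv₁ (hb₁.trans hb)
    refine ⟨v₂, hv₂, hb₂, (h₁.seq
      (.ite_false _ (Bool.eq_false_iff.2 (mt ht₁.1 he)) h₂)).mono ?_⟩
    simp only [List.length_cons, Polynomial.eval_add, Polynomial.eval_one]
    nlinarith

theorem Tests.simulates_brk {Γ : VarEnv V} {x : Fin m → V} {E : SFrag m M} {e : Expr S V}
    {pe : Polynomial ℕ} (hE : Tests Γ x E e pe) :
    Simulates Γ x (E.seq (setCtl fun v => { v with broken := v.test })) (.brk e) (pe + 1) := by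
  intro i μ b μ' t N v h hμ' ht hv hb
  have key : ∀ b : Flag, (b.isBroken = true ↔ e.eval μ = wordOne) → BoundedFrom Γ 0 N μ →
      ∃ v' : Ctl M, v'.Idle ∧ v'.broken = b.isBroken ∧
        Exec (E.seq (setCtl fun v => { v with broken := v.test })) (v, regsOf x μ [])
          (v', regsOf x μ []) (1 * (pe + 1).eval N) := by
    intro b hbe hμ
    obtain ⟨v₁, hv₁, -, ht₁, h₁⟩ := hE N μ v hμ hv
    refine ⟨{ v₁ with broken := v₁.test }, hv₁, Bool.eq_iff_iff.2 (ht₁.trans hbe.symm),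
      (h₁.seq (exec_setCtl fun v => { v with broken := v.test })).mono (by simp)⟩
  cases h with
  | brk_true he => exact key _ (by simpa [Flag.isBroken] using he) (by simpa using ht)
  | brk_false he => exact key _ (by simpa [Flag.isBroken] using he) (by simpa using ht)

/-- The fragment keeps the value of the guard in the test bit. A break in the body clears the test
bit, so that the loop is left, and the bit for breaking the flow is reset after the loop. -/
theorem Simulates.loop {Γ : VarEnv V} {x : Fin m → V} {E F : SFrag m M} {e : Expr S V}
    {a : LStmt S V} {τ : ℕ} {pe p : Polynomial ℕ} (hE : Tests Γ x E e pe)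
    (hF : Simulates Γ x F a p) :
    Simulates Γ x (E.seq ((Frag.loop Ctl.test (F.seq (.ite Ctl.broken
      (setCtl fun v => { v with test := false }) E))).seq
      (setCtl fun v => { v with broken := false }))) (.loop τ e a) (2 * pe + p + 5) := by
  -- the loop of the fragment is entered after the first evaluation of the guard
  have key : ∀ {i μ c b μ' t} {N : ℕ} (v : Ctl M), Trace i μ c b μ' t → c = .loop τ e a →
      BoundedFrom Γ 0 N μ' → (∀ r ∈ t, BoundedFrom Γ 0 N r.2) → v.Idle → v.broken = false →
      (v.test = true ↔ e.eval μ = wordOne) → b = .cont ∧ ∃ v' : Ctl M, v'.Idle ∧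
        Exec (Frag.loop Ctl.test (F.seq (.ite Ctl.broken
          (setCtl fun v => { v with test := false }) E))) (v, regsOf x μ []) (v', regsOf x μ' [])
          (t.length * (pe + p + 4).eval N) := by
    intro i μ c b μ' t N v h hc hμ' ht hv hb htest
    simp only [Polynomial.eval_add, Polynomial.eval_ofNat]
    induction h generalizing v with
    | loop_false he =>
      cases hc
      refine ⟨rfl, v, hv, (Exec.loop_false _ (Bool.eq_false_iff.2 (mt htest.1 he))).mono ?_⟩
      simp only [List.length_singleton]
      omega
    | loop_true he h₁ h₂ _ ih =>
      cases hc
      rw [List.forall_mem_cons, List.forall_mem_append] at ht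
      obtain ⟨l, hl⟩ := h₂.head_mem
      obtain ⟨v₁, hv₁, hb₁, h₁'⟩ := hF _ _ _ _ _ N v h₁ (ht.2.2 _ hl) ht.2.1 hv hb
      obtain ⟨v₂, hv₂, hb₂, ht₂, hE'⟩ := hE N _ v₁ (ht.2.2 _ hl) hv₁
      obtain ⟨-, v₃, hv₃, h₃⟩ := ih v₂ rfl hμ' ht.2.2 hv₂ (hb₂.trans hb₁) ht₂
      refine ⟨rfl, v₃, hv₃, (Exec.loop_true (htest.2 he)
        (h₁'.seq (.ite_false _ hb₁ hE')) h₃).mono ?_⟩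
      simp only [List.length_cons, List.length_append]
      nlinarith
    | loop_broken he h₁ _ =>
      cases hc
      rw [List.forall_mem_cons] at ht
      obtain ⟨v₁, hv₁, hb₁, h₁'⟩ := hF _ _ _ _ _ N v h₁ hμ' ht.2 hv hb
      refine ⟨rfl, { v₁ with test := false }, hv₁, (Exec.loop_true (p := fun v => v.test)
        (htest.2 he) (h₁'.seq (.ite_true _ hb₁ (exec_setCtl fun v => { v with test := false })))
        (.loop_false _ rfl)).mono ?_⟩
      simp only [List.length_cons]
      nlinarith
    | _ => cases hc
  intro i μ b μ' t N v h hμ' ht hv hb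
  obtain ⟨l, hl⟩ := h.head_mem
  obtain ⟨v₁, hv₁, hb₁, ht₁, h₁⟩ := hE N μ v (ht _ hl) hv
  obtain ⟨rfl, v₂, hv₂, h₂⟩ := key v₁ h rfl hμ' ht hv₁ (hb₁.trans hb) ht₁
  refine ⟨{ v₂ with broken := false }, hv₂, rfl,
    (h₁.seq (h₂.seq (exec_setCtl fun v => { v with broken := false }))).mono ?_⟩
  have := h.length_pos
  simp only [Polynomial.eval_add, Polynomial.eval_ofNat, Polynomial.eval_mul]
  nlinarith

/-- Every statement with typable expressions can be simulated, given machines for the operators in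
its expressions. -/
theorem LStmt.Supported.exists_simulates {Γ : VarEnv V} {Δ : OpEnv S} (hΔ : Δ.Safe) {x : Fin m → V}
    (hinj : x.Injective) (hx : ∀ y τ, Γ y = some τ → ∃ i, x i = y) {f : Fin n → S.Op}
    (hf : ∀ o ∈ Δ.dom, ∃ i, f i = o)
    (comp : ∀ i, TM2ComputableInPolyTime (αΓ := Option A) (βΓ := A) encodeTuple (fun v => v)
      (S.sem (f i))) {a : LStmt S V} (ha : a.Supported Γ Δ) :
    ∃ (F : SFrag m fun i => (comp i).toTM2ComputableAux) (p : Polynomial ℕ),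
      Simulates Γ x F a p := by
  have hguard {e : Expr S V} (he : ∃ i o τ, ExprTyped Γ Δ i o e τ) :
      ∃ (F : SFrag m fun i => (comp i).toTM2ComputableAux) (p : Polynomial ℕ), Tests Γ x F e p := by
    obtain ⟨i, o, τ, he⟩ := he
    obtain ⟨F, p, hF⟩ := he.exists_pushes hΔ hx hf comp
    obtain ⟨q, hq⟩ := he.exists_polynomial hΔ
    exact ⟨_, _, hF.tests hq⟩
  induction a with
  | skip => exact ⟨_, _, simulates_skip⟩
  | assign y e =>
    obtain ⟨⟨τ, hy⟩, i, o, τ', he⟩ := ha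
    obtain ⟨j, rfl⟩ := hx y τ hy
    obtain ⟨F, p, hF⟩ := he.exists_pushes hΔ hx hf comp
    exact ⟨_, _, simulates_assign hinj hF hy⟩
  | seq _ _ ih₁ ih₂ =>
    obtain ⟨F, p, hF⟩ := ih₁ ha.1
    obtain ⟨G, q, hG⟩ := ih₂ ha.2
    exact ⟨_, _, hF.seq hG⟩
  | ite e _ _ ih₁ ih₂ =>
    obtain ⟨E, pe, hE⟩ := hguard ha.1
    obtain ⟨F, p, hF⟩ := ih₁ ha.2.1
    obtain ⟨G, q, hG⟩ := ih₂ ha.2.2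
    exact ⟨_, _, .ite hE hF hG⟩
  | loop τ e _ ih =>
    obtain ⟨E, pe, hE⟩ := hguard ha.1
    obtain ⟨F, p, hF⟩ := ih ha.2
    exact ⟨_, _, .loop hE hF⟩
  | brk e =>
    obtain ⟨E, pe, hE⟩ := hguard ha
    exact ⟨_, _, hE.simulates_brk⟩

end Statements

/-! ### Running programs by a machine -/

section Programs

open Turing

variable {A : Type} {m n : ℕ} {M : Fin n → TM2ComputableAux (Option A) A}

section Sequences

variable {S : Operators.{u} A} {V : Type v}

/-- Execute a list of fragments one after the other. -/
def seqAll : List (SFrag m M) → SFrag m M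
  | [] => setCtl id
  | F :: Fs => F.seq (seqAll Fs)

/-- Move words from the work stack to the variables with the indices `js`. -/
theorem does_storeWords [DecidableEq V] {x : Fin m → V} (hx : x.Injective) {k : ℕ}
    (idx : Fin k → Fin m) (w : Fin k → Word A) {N : ℕ} (hw : ∀ i, (w i).length ≤ N)
    (is : List (Fin k)) (μ : Store A V) (hμ : ∀ y, (μ y).length ≤ N) :
    Does (M := M) (seqAll (is.map fun i => storeWord (idx i)))
      (regsOf x μ (is.flatMap fun i => enc (w i)))
      (regsOf x (is.foldl (fun μ i => Function.update μ (x (idx i)) (w i)) μ) [])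
      (is.length * (3 * N + 4) + 1) := by
  induction is generalizing μ with
  | nil =>
    refine .of_exec' fun v _ => ?_
    simpa [seqAll] using exec_setCtl id
  | cons i is ih =>
    have h₁ := does_storeWord (M := M) hx (idx i) μ (w i) (is.flatMap fun i => enc (w i))
    have h₂ := ih (Function.update μ (x (idx i)) (w i)) fun y => by
      by_cases hy : y = x (idx i)
      · subst hy; simpa using hw i
      · simpa [hy] using hμ y
    refine (h₁.seq h₂).cast rfl ?_
    have := hw i
    have := hμ (x (idx i))
    simp only [List.length_cons, add_mul]
    omega

theorem does_clearVars (r : Regs m M) {N : ℕ} (hN : ∀ i, (r.vars i).length ≤ N)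
    (is : List (Fin m)) :
    Does (seqAll (is.map fun i => clear (.var i))) r
      { r with vars := fun i => if i ∈ is then [] else r.vars i } (is.length * (N + 1) + 1) := by
  induction is generalizing r with
  | nil =>
    refine .of_exec' fun v _ => ?_
    simpa [seqAll] using exec_setCtl (v := v) (r := r) id
  | cons i is ih =>
    have h₁ : Does (clear (.var i)) r _ _ := .of_exec fun v => exec_clear_var i
    have h₂ := ih { r with vars := Function.update r.vars i [] } fun j => by
      by_cases hj : j = i
      · subst hj; simp
      · simpa [hj] using hN j
    refine (h₁.seq h₂).cast ?_ ?_
    · ext1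
      · funext j
        by_cases hj : j = i
        · subst hj; simp
        · simp [hj]
      all_goals rfl
    · have := hN i
      simp only [List.length_cons, add_mul]
      omega

end Sequences

/-- The initial internal state. -/
def Ctl.init : Ctl M := ⟨none, false, false, fun i => (M i).tm.initialState⟩

/-- The multi-stack machine executing a fragment, with the work stack as its input stack. -/
noncomputable def machineOf [Fintype A] (F : SFrag m M) : FinTM2 where
  K := Loc m M
  k₀ := .work
  k₁ := .out
  Γ l := l.Alph
  Λ := F.Λ
  main := F.entry
  ΛFin := F.fin
  σ := Ctl M
  initialState := .init
  Γk₀Fin := inferInstanceAs (Fintype (Option A))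
  m := F.m

/-- The memory with an input on the work stack and an output on the output stack. -/
def Regs.io (W : List (Option A)) (u : List A) : Regs m M where
  vars _ := []
  work := W
  tmp := []
  cnt := []
  out := u
  ops _ _ := []

theorem Regs.io_stk_input [DecidableEq (Loc m M)] (W : List (Option A)) :
    (Regs.io W [] : Regs m M).stk =
      Function.update (β := fun l : Loc m M => List l.Alph) (fun _ => []) .work W := by
  funext l
  by_cases hl : l = .work
  · subst hl; rw [Function.update_self]; rfl
  · rw [Function.update_of_ne hl]; cases l <;> first | rfl | exact absurd rfl hl

theorem Regs.io_stk_output [DecidableEq (Loc m M)] (u : List A) :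
    (Regs.io [] u : Regs m M).stk =
      Function.update (β := fun l : Loc m M => List l.Alph) (fun _ => []) .out u := by
  funext l
  by_cases hl : l = .out
  · subst hl; rw [Function.update_self]; rfl
  · rw [Function.update_of_ne hl]; cases l <;> first | rfl | exact absurd rfl hl

/-- A function is computable in polynomial time if a fragment takes the encoded arguments from the
work stack to its value on the output stack, cleaning up all other stacks. -/
theorem inFP_of_exec [Fintype A] {k : ℕ} {g : (Fin k → Word A) → Word A} (F : SFrag m M)
    (p : Polynomial ℕ) (h : ∀ w, Exec F (.init, .io (encodeTuple w) []) (.init, .io [] (g w))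
      (p.eval (encodeTuple w).length)) : InFP g := by
  refine ⟨⟨⟨machineOf F, Equiv.refl _, Equiv.refl _⟩, p, fun w => Classical.choice ?_⟩⟩
  obtain ⟨t, ht, h⟩ := h w
  have h₀ : initList (machineOf F) (List.map (Equiv.refl _).invFun (encodeTuple w)) =
      ⟨some F.entry, Ctl.init, (Regs.io (encodeTuple w) [] : Regs m M).stk⟩ := by
    refine ((congrArg _ (List.map_id _)).trans (initList_eq (machineOf F) _)).trans ?_
    refine congrArg (TM2.Cfg.mk _ _) ?_
    exact (Regs.io_stk_input _).symm
  have h₁ : haltList (machineOf F) (List.map (Equiv.refl _).invFun (g w)) =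
      ⟨none, Ctl.init, (Regs.io [] (g w) : Regs m M).stk⟩ := by
    refine ((congrArg _ (List.map_id _)).trans (haltList_eq (machineOf F) _)).trans ?_
    refine congrArg (TM2.Cfg.mk _ _) ?_
    exact (Regs.io_stk_output _).symm
  refine ⟨⟨⟨t, ?_⟩, ht⟩⟩
  have h' := reach_iff_iterate.1 h
  refine (congrArg _ (congrArg some h₀)).trans (Eq.trans ?_ (congrArg some h₁.symm))
  exact h'

section

variable {S : Operators.{u} A} {V : Type v} [DecidableEq V]

theorem length_le_encodeTuple {k : ℕ} (w : Fin k → Word A) (i : Fin k) :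
    (w i).length ≤ (encodeTuple w).length := by
  rw [encodeTuple_eq, List.length_flatMap, List.map_ofFn, List.sum_ofFn]
  refine le_trans ?_ (Finset.single_le_sum (f := fun i => (enc (w i)).length)
    (fun _ _ => Nat.zero_le _) (Finset.mem_univ i))
  simp [enc]

theorem Program.inputStore_length_le [BitAlphabet A] (P : Program S V)
    (w : Fin P.arity → Word A) (y : V) :
    (P.inputStore w y).length ≤ (encodeTuple w).length := by
  have key (is : List (Fin P.arity)) (μ : Store A V)
      (hμ : ∀ y, (μ y).length ≤ (encodeTuple w).length) : ((is.foldl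
        (fun μ i => Function.update μ (P.params i) (w i)) μ) y).length ≤
          (encodeTuple w).length := by
    induction is generalizing μ with
    | nil => exact hμ y
    | cons i is ih =>
      refine ih _ fun z => ?_
      by_cases hz : z = P.params i
      · subst hz; simpa using length_le_encodeTuple w i
      · simpa [hz] using hμ z
  exact key _ _ (by simp)

/-- If a simulation of the body of a program is available and all runs of the body are polynomially
bounded, the program computes a polynomial-time function. -/
theorem Program.inFP_of_simulates [Fintype A] [BitAlphabet A] (P : Program S V) {Γ : VarEnv V}
    {x : Fin m → V} (hx : x.Injective) (hΓ : ∀ i, ∃ τ, Γ (x i) = some τ)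
    {idx : Fin P.arity → Fin m} (hidx : ∀ i, x (idx i) = P.params i) {j : Fin m}
    (hj : x j = P.result) {F : SFrag m M} {a : LStmt S V} {pF p q : Polynomial ℕ}
    (hF : Simulates Γ x F a pF) {res : (Fin P.arity → Word A) → Store A V}
    {t : (Fin P.arity → Word A) → List (ℕ × Store A V)}
    (h : ∀ w, Trace 0 (P.inputStore w) a .cont (res w) (t w))
    (ht : ∀ w, (t w).length ≤ p.eval (encodeTuple w).length)
    (hres : ∀ w, BoundedFrom Γ 0 (q.eval (encodeTuple w).length) (res w))
    (hq : ∀ w, ∀ r ∈ t w, BoundedFrom Γ 0 (q.eval (encodeTuple w).length) r.2) :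
    InFP fun w => res w P.result := by
  classical
  obtain ⟨d⟩ : Nonempty A := ⟨BitAlphabet.zero⟩
  refine inFP_of_exec ((seqAll ((List.finRange P.arity).map fun i => storeWord (idx i))).seq <|
    F.seq <| (move (.var j) .tmp id id).seq <| (move .tmp .out id fun a => a.getD d).seq <|
    (seqAll ((List.finRange m).map fun i => clear (.var i))).seq (setCtl fun _ => .init))
    ((P.arity : Polynomial ℕ) * (3 * .X + 4) + 1 + (p * pF.comp q + (2 * q + 2 +
      ((m : Polynomial ℕ) * (q + 1) + 1 + 1)))) fun w => ?_
  set L := (encodeTuple w).length with hL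
  have h₀ : (Regs.io (encodeTuple w) [] : Regs m M) =
      regsOf x (fun _ => []) ((List.finRange P.arity).flatMap fun i => enc (w i)) := by
    rw [encodeTuple_eq, List.ofFn_eq_map, List.flatMap_map]
    rfl
  obtain ⟨v₁, hv₁, hb₁, h₁⟩ := does_storeWords (M := M) hx idx w (length_le_encodeTuple w)
    (List.finRange P.arity) (fun _ => []) (by simp) .init fun _ => rfl
  have hstore : (List.finRange P.arity).foldl
      (fun μ i => Function.update μ (x (idx i)) (w i)) (fun _ => []) = P.inputStore w := by
    simp only [hidx]
    rfl
  rw [hstore, ← h₀] at h₁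
  obtain ⟨v₂, hv₂, -, h₂⟩ := hF _ _ _ _ _ _ v₁ (h w) (hres w) (hq w) hv₁ hb₁
  have hlen (i : Fin m) : (res w (x i)).length ≤ q.eval L := by
    obtain ⟨τ, hτ⟩ := hΓ i
    exact hres w _ _ hτ (Nat.zero_le _)
  obtain ⟨v₅, hv₅, -, h₅⟩ := does_clearVars (M := M)
    { (regsOf x (res w) [] : Regs m M) with
      vars := Function.update (regsOf x (res w) [] : Regs m M).vars j [], out := res w P.result }
    (N := q.eval L) (fun i => by
      by_cases hi : i = j
      · subst hi; simp
      · simpa [hi, regsOf] using hlen i) (List.finRange m) { v₂ with buf := none } hv₂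
  have hlast : (Regs.io [] (res w P.result) : Regs m M) = { (regsOf x (res w) [] : Regs m M) with
      vars := fun i => if i ∈ List.finRange m then [] else
        Function.update (regsOf x (res w) [] : Regs m M).vars j [] i, out := res w P.result } := by
    ext1 <;> simp [Regs.io, regsOf]
  have h₆ := h₅.seq (exec_setCtl fun _ => Ctl.init)
  rw [← hlast] at h₆
  have h₃' : Exec (move (.var j) .tmp id id) (v₂, regsOf x (res w) [])
      ({ v₂ with buf := none }, { (regsOf x (res w) [] : Regs m M) with
        vars := Function.update (regsOf x (res w) [] : Regs m M).vars j []
        tmp := ((res w P.result).map some).reverse }) ((res w P.result).length + 1) := by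
    simpa [regsOf, hj] using exec_move_var_tmp (v := v₂) (r := (regsOf x (res w) [] : Regs m M)) j
  have h₄' : Exec (move .tmp .out id fun a => a.getD d) ({ v₂ with buf := none },
      { (regsOf x (res w) [] : Regs m M) with
        vars := Function.update (regsOf x (res w) [] : Regs m M).vars j []
        tmp := ((res w P.result).map some).reverse })
      ({ v₂ with buf := none }, { (regsOf x (res w) [] : Regs m M) with
        vars := Function.update (regsOf x (res w) [] : Regs m M).vars j []
        out := res w P.result }) ((res w P.result).length + 1) := by
    have := exec_move_tmp_out (M := M) (v := { v₂ with buf := none }) (r :=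
      { (regsOf x (res w) [] : Regs m M) with
        vars := Function.update (regsOf x (res w) [] : Regs m M).vars j []
        tmp := ((res w P.result).map some).reverse }) d
    simpa [regsOf, Function.comp_def] using this
  refine (h₁.seq (h₂.seq (h₃'.seq (h₄'.seq h₆)))).mono ?_
  have hr := hlen j
  rw [hj] at hr
  have hmul := Nat.mul_le_mul_right ((pF.comp q).eval L) (ht w)
  rw [Polynomial.eval_comp] at hmul
  simp only [Polynomial.eval_add, Polynomial.eval_mul, Polynomial.eval_natCast,
    Polynomial.eval_ofNat, Polynomial.eval_X, Polynomial.eval_one, Polynomial.eval_comp,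
    List.length_finRange]
  simp only [← hL, Nat.cast_id] at *
  omega

end

end Programs

end Declass


theorem mainTheorem2 {A : Type} [Fintype A] [Declass.BitAlphabet A]
    {V : Type*} [DecidableEq V] (S : Declass.Operators A) (P : Declass.Program S V)
    (hsafe : P.Safe) (hap : P.Aperiodic) (hbrk : P.NoEscapingBreak) :
    ∃ f : (Fin P.arity → Declass.Word A) → Declass.Word A,
      Declass.InFP f ∧ ∀ w r, P.Computes w r ↔ f w = r := by
  obtain ⟨Δ, hΔ, Γ, τ, hty⟩ := hsafe
  -- finitely many variables and operators matter; the input and output variables are added to them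
  obtain ⟨X, O, hX, hO, hty⟩ := hty.exists_finite
  set Y := insert P.result (X ∪ Set.range P.params)
  have hX' : Y.Finite :=
    (hX.union (Set.finite_range _)).insert _
  replace hty := hty Y O
    (Set.subset_union_left.trans (Set.subset_insert _ _)) subset_rfl
  replace hΔ := hΔ.restrict O
  have hdom : (Δ.restrict O).dom.Finite := hO.inter_of_right _
  obtain ⟨m, x, hinj, hx⟩ := hX'.fin_param
  obtain ⟨n, f, -, hf⟩ := hdom.fin_param
  have comp (i : Fin n) := Classical.choice
    (hΔ (f i) (hf ▸ Set.mem_range_self i)).2.1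
  have hΓx (y : V) (l : ℕ) (hy : Γ.restrict Y y = some l) : ∃ i, x i = y :=
    (Set.ext_iff.1 hx y).2 (Declass.VarEnv.mem_of_restrict hy)
  obtain ⟨a, ha, hsupp, p, q, htr⟩ := hty.exists_trace hΔ (X := hX'.toFinset)
    (fun y l hy => hX'.mem_toFinset.2 (Declass.VarEnv.mem_of_restrict hy)) rfl rfl
  obtain ⟨F, pF, hF⟩ := hsupp.exists_simulates hΔ hinj hΓx
    (fun o ho => (Set.ext_iff.1 hf o).2 ho) comp
  -- on the input `w`, the body ends normally, as no break escapes
  have hrun (w) : ∃ μ' t, Declass.Trace 0 (P.inputStore w) a .cont μ' t ∧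
      t.length ≤ p.eval (Declass.encodeTuple w).length ∧
      Declass.BoundedFrom (Γ.restrict Y) 0 (q.eval (Declass.encodeTuple w).length) μ' ∧
      ∀ r ∈ t, Declass.BoundedFrom (Γ.restrict Y) 0
        (q.eval (Declass.encodeTuple w).length) r.2 := by
    obtain ⟨b, μ', t, h, hp⟩ := htr (Declass.encodeTuple w).length (P.inputStore w)
      (fun y _ _ _ => P.inputStore_length_le w y) (hap.aperiodicFrom _)
    cases b with
    | cont => exact ⟨μ', t, h, hp⟩
    | broken => exact absurd (ha ▸ h.eval) (hbrk w μ')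
  choose res t h ht hres hq using hrun
  have hmem (y : V) (hy : y ∈ Y) : ∃ i, x i = y :=
    (Set.ext_iff.1 hx y).2 hy
  choose idx hidx using fun i => hmem (P.params i) (.inr (.inr ⟨i, rfl⟩))
  obtain ⟨j, hj⟩ := hmem P.result (.inl rfl)
  refine ⟨fun w => res w P.result, P.inFP_of_simulates hinj (fun i => ?_) hidx hj hF h ht hres hq,
    fun w r => ⟨?_, ?_⟩⟩
  · exact ⟨_, if_pos (hx ▸ Set.mem_range_self i)⟩
  · rintro ⟨μ', hμ', rfl⟩
    rw [(Declass.Eval.deterministic hμ' (ha ▸ (h w).eval)).2]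
  · rintro rfl
    exact ⟨res w, ha ▸ (h w).eval, rfl⟩
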